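/- Let $L$ be a smooth manifold (without boundary, Hausdorff, second countable). A Levi flat structure on $L$ is a pair $(\xi,J)$ where $\xi\subset TL$ is a smooth integrable (involutive) distribution of codimension $1$ and $J:\xi\to\xi$ is a smooth bundle map with $J^2=-I$ that is integrable along the leaves, i.e. its Nijenhuis tensor $[JV,JW]-[V,W]-J[JV,W]-J[V,JW]$ vanishes for all $V,W$ tangent to $\xi$. Fix a Levi flat structure $(\xi,J)$ and a DGLA defining couple $(\gamma,X)$: a smooth $1$-form $\gamma$ and a smooth vector field $X$ with $\ker\gamma=\xi$ and $\gamma(X)=1$. **Notation.** Let $\mathcal Z^1(L)=\{\alpha\in\Lambda^1(L):\alpha(X)=0\}$ and let $\Lambda_J^{0,1}(\xi)\otimes\xi$ be the set of smooth $S:\xi\to\xi$ with $SJ=-JS$. For $1$-forms put $\{a,b\}=\mathcal L_Xa\wedge b-a\wedge\mathcal L_Xb$ and $\delta\alpha=d\alpha+\{\gamma,\alpha\}$. For $\alpha\in\mathcal Z^1(L)$ put $\xi_\alpha=\ker(\gamma+\alpha)$, $\omega_\alpha(V)=V-\alpha(V)X$ (so $\omega_\alpha(\xi)=\xi_\alpha$)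 and $[V,W]_\alpha=\omega_\alpha^{-1}[\omega_\alpha V,\omega_\alpha W]$. For a bracket $[\cdot,\cdot]$ on the vector fields tangent to $\xi$, put $$N(V,W)=[JV,JW]-[V,W]-J[JV,W]-J[V,JW],\qquad (\bar\partial W)(V)=\tfrac12([V,W]+J[JV,W])+\tfrac14N(V,W),$$ $$\bar\partial S(V,W)=\bar\partial(SW)(V)-\bar\partial(SV)(W)-\tfrac12S([V,W]-[JV,JW]),$$ $$[S,S](V,W)=[SV,SW]-[JSV,JSW]-S\big([SV,W]+[V,SW]+J[V,JSW]+J[JSV,W]\big)-\tfrac12\big(SN(SV,W)+SN(V,SW)-N(SV,SW)\big),$$ $$[[S,S]](V,W)=[S,S](V,W)-\tfrac12S\big(N(V,W)-N(SV,SW)\big);$$ write $\bar\partial^\alpha_J$ and $[[\cdot,\cdot]]_\alpha$ for these operators when the bracket is $[\cdot,\cdot]_\alpha$. Finally let $T(V)=[V,X]-\gamma([V,X])X$, $H(V)=\tfrac12(T(V)+JT(JV))$ and $(\alpha^{0,1}_J\wedge H)(V,W)=\tfrac12\big(\alpha(V)HW+\alpha(JV)JHW-\alpha(W)HV-\alpha(JW)JHV\big)$.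 Let $\mathfrak{MC}_{\delta,\mathcal{LF}}(L)$ be the set of all $(\alpha,S)\in\mathcal Z^1(L)\times(\Lambda_J^{0,1}(\xi)\otimes\xi)$ such that $$\delta\alpha+\tfrac12\{\alpha,\alpha\}=0,\qquad \bar\partial_J^\alpha S+\tfrac12[[S,S]]_\alpha=-\alpha_J^{0,1}\wedge H ,$$ and let $\mathfrak{MC}^\circ$ be the subset where $I+S$ is everywhere invertible. To a pair $(\alpha,S)$ with $I+S$ invertible associate $(\xi_\alpha,J_{\alpha,S})$, where $J_{\alpha,S}=\omega_\alpha(I+S)J(I+S)^{-1}\omega_\alpha^{-1}$. **Gauge action.** For $\Phi\in\mathrm{Diff}(L)$ and $(\alpha,S)$ with $I+S$ invertible let $$\beta=\chi(\Phi)(\alpha)=\big(\Phi^*(\gamma+\alpha)(X)\big)^{-1}\Phi^*(\gamma+\alpha)-\gamma,\qquad S_{\chi(\Phi)(\alpha)}=(J+\widetilde J)^{-1}(J-\widetilde J),\quad \widetilde J=\omega_\beta^{-1}\Phi_*^{-1}J_{\alpha,S}\Phi_*\omega_\beta ,$$ which is defined when $\Phi^*(\gamma+\alpha)(X)$ vanishes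 nowhere and $J+\widetilde J$ is everywhere invertible; $S_{\chi(\Phi)(\alpha)}$ is the $Q$ with $QJ=-JQ$ and $\widetilde J=(I+Q)J(I+Q)^{-1}$. Write $(\alpha,S)\sim_{\mathcal G}(\beta,Q)$ if there is a $\Phi\in\mathrm{Diff}(L)$ for which these are defined, with $\beta=\chi(\Phi)(\alpha)$ and $Q=S_{\chi(\Phi)(\alpha)}$. **Deformations.** The deformations of $(\xi,J)$ are the Levi flat structures $(\xi',J')$ on $L$ that are close to $(\xi,J)$ in the following sense: $\xi'$ is everywhere transverse to $X$ and, with $\pi:\xi'\to\xi$ the projection along $X$, $J+\pi J'\pi^{-1}$ is everywhere invertible. The moduli space of deformations of $(\xi,J)$ is the set of these structures modulo the relation of being carried to one another by a diffeomorphism of $L$. **Statement.** 1. For $(\alpha,S)\in\mathcal Z^1(L)\times(\Lambda_J^{0,1}(\xi)\otimes\xi)$ with $I+S$ invertible, $(\xi_\alpha,J_{\alpha,S})$ is a Levi flat structure if and only if $(\alpha,S)\in\mathfrak{MC}_{\delta,\mathcal{LF}}(L)$; the pair $(0,0)$ gives $(\xi,J)$; and $(\alpha,S)\mapsto(\xi_\alpha,J_{\alpha,S})$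 is a bijection from $\mathfrak{MC}^\circ$ onto the set of deformations of $(\xi,J)$. 2. The gauge action preserves $\mathfrak{MC}^\circ$: if it is defined for $\Phi$ and $(\alpha,S)\in\mathfrak{MC}^\circ$, then $(\chi(\Phi)(\alpha),S_{\chi(\Phi)(\alpha)})\in\mathfrak{MC}^\circ$. 3. $\sim_{\mathcal G}$ is an equivalence relation on $\mathfrak{MC}^\circ$, and $(\alpha,S)\sim_{\mathcal G}(\beta,Q)$ if and only if some diffeomorphism of $L$ carries $(\xi_\alpha,J_{\alpha,S})$ to $(\xi_\beta,J_{\beta,Q})$. 4. Consequently $(\alpha,S)\mapsto(\xi_\alpha,J_{\alpha,S})$ induces a bijection from $\mathfrak{MC}^\circ/\!\sim_{\mathcal G}$ onto the moduli space of deformations of $(\xi,J)$. -/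

import Mathlib

open Set
open scoped Manifold ContDiff

noncomputable section

namespace LeviFlat

/-! ### Vector fields and one-forms on a manifold without boundary of dimension `n` -/

section Fields

variable {n : ℕ} {L : Type*} [TopologicalSpace L] [ChartedSpace (EuclideanSpace ℝ (Fin n)) L]

/-- Vector fields (no regularity). -/
abbrev VField (n : ℕ) (L : Type*) [TopologicalSpace L]
    [ChartedSpace (EuclideanSpace ℝ (Fin n)) L] : Type _ :=
  (x : L) → TangentSpace (𝓡 n) x

/-- One-forms (no regularity). -/
abbrev OneForm (n : ℕ) (L : Type*) [TopologicalSpace L]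
    [ChartedSpace (EuclideanSpace ℝ (Fin n)) L] : Type _ :=
  (x : L) → (TangentSpace (𝓡 n) x →L[ℝ] ℝ)

/-- Smooth vector fields. -/
def SmoothField [IsManifold (𝓡 n) ∞ L] (V : VField n L) : Prop :=
  ContMDiff (𝓡 n) (𝓡 n).tangent ∞ (fun x => (⟨x, V x⟩ : TangentBundle (𝓡 n) L))

/-- Smoothness of a one-form on an open set `U`: it takes smooth vector fields to functions
that are smooth on `U`. -/
def SmoothFormOn [IsManifold (𝓡 n) ∞ L] (θ : OneForm n L) (U : Set L) : Prop :=
  ∀ V : VField n L, SmoothField V → ContMDiffOn (𝓡 n) 𝓘(ℝ, ℝ) ∞ (fun x => θ x (V x)) U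

/-- The Lie bracket of vector fields. -/
def lie (V W : VField n L) : VField n L := VectorField.mlieBracket (𝓡 n) V W

/-- The derivative `V f` of a function `f` along a vector field `V`. -/
def dirDeriv (V : VField n L) (f : L → ℝ) (x : L) : ℝ := mfderiv (𝓡 n) 𝓘(ℝ, ℝ) f x (V x)

/-- `dθ (V, W) = V (θ W) - W (θ V) - θ [V, W]`. -/
def extD (θ : OneForm n L) (V W : VField n L) (x : L) : ℝ :=
  dirDeriv V (fun y => θ y (W y)) x - dirDeriv W (fun y => θ y (V y)) x - θ x (lie V W x)

/-- The Lie derivative of a one-form: `(𝓛_X θ) V = X (θ V) - θ [X, V]`. -/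
def lieDer (X : VField n L) (θ : OneForm n L) (V : VField n L) (x : L) : ℝ :=
  dirDeriv X (fun y => θ y (V y)) x - θ x (lie X V x)

/-- The bracket `{a, b} = 𝓛_X a ∧ b - a ∧ 𝓛_X b` of two one-forms, a two-form. The wedge is
normalised by `(a ∧ b) (V, W) = a V * b W - a W * b V`. -/
def formBracket (X : VField n L) (a b : OneForm n L) (V W : VField n L) (x : L) : ℝ :=
  (lieDer X a V x * b x (W x) - lieDer X a W x * b x (V x))
    - (a x (V x) * lieDer X b W x - a x (W x) * lieDer X b V x)

end Fields

/-! ### Complex Lie algebras of derivation type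

The operators attached to a bracket `br` and to operators `J`, `S` on vector fields. -/

section Derivation

variable {g : Type*} [AddCommGroup g] [Module ℝ g]

/-- The Nijenhuis tensor of `J` with respect to the bracket `br`. -/
def nijenhuis (br : g → g → g) (J : g → g) (V W : g) : g :=
  br (J V) (J W) - br V W - J (br (J V) W) - J (br V (J W))

/-- `(∂̄ W) (V)`, for `W` an element of the Lie algebra. -/
def dbarVec (br : g → g → g) (J : g → g) (W V : g) : g :=
  (1 / 2 : ℝ) • (br V W + J (br (J V) W)) + (1 / 4 : ℝ) • nijenhuis br J V W

/-- `(∂̄ S) (V, W)`, for `S` a `(0,1)`-form with values in the Lie algebra. -/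
def dbarEnd (br : g → g → g) (J S : g → g) (V W : g) : g :=
  dbarVec br J (S W) V - dbarVec br J (S V) W
    - (1 / 2 : ℝ) • S (br V W - br (J V) (J W))

/-- `[S, S] (V, W)`. -/
def sBracket (br : g → g → g) (J S : g → g) (V W : g) : g :=
  br (S V) (S W) - br (J (S V)) (J (S W))
    - S (br (S V) W + br V (S W) + J (br V (J (S W))) + J (br (J (S V)) W))
    - (1 / 2 : ℝ) • (S (nijenhuis br J (S V) W) + S (nijenhuis br J V (S W))
        - nijenhuis br J (S V) (S W))

/-- `[[S, S]] (V, W) = [S, S] (V, W) - 1/2 S (N (V, W) - N (S V, S W))`. -/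
def sDoubleBracket (br : g → g → g) (J S : g → g) (V W : g) : g :=
  sBracket br J S V W
    - (1 / 2 : ℝ) • S (nijenhuis br J V W - nijenhuis br J (S V) (S W))

end Derivation

/-! ### Levi flat structures -/

section Structures

variable {n : ℕ} {L : Type*} [TopologicalSpace L] [ChartedSpace (EuclideanSpace ℝ (Fin n)) L]

/-- A field `ξ` of tangent subspaces and a field `J` of endomorphisms of `ξ` (no condition). -/
structure EndoDistribution (n : ℕ) (L : Type*) [TopologicalSpace L]
    [ChartedSpace (EuclideanSpace ℝ (Fin n)) L] where
  ξ : (x : L) → Submodule ℝ (TangentSpace (𝓡 n) x)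
  J : (x : L) → Module.End ℝ (ξ x)

/-- The vector field `V` is tangent to the distribution `ξ`. -/
def TangentTo (ξ : (x : L) → Submodule ℝ (TangentSpace (𝓡 n) x)) (V : VField n L) : Prop :=
  ∀ x, V x ∈ ξ x

open Classical in
/-- The action `V ↦ A V` on vector fields tangent to `ξ` of a field `A` of endomorphisms of `ξ`.
Vectors that are not in `ξ` are sent to `0`; this value is never relevant. -/
def act {ξ : (x : L) → Submodule ℝ (TangentSpace (𝓡 n) x)} (A : (x : L) → Module.End ℝ (ξ x))
    (V : VField n L) : VField n L :=
  fun x => if h : V x ∈ ξ x then ((A x ⟨V x, h⟩ : ξ x) : TangentSpace (𝓡 n) x) else 0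

variable [IsManifold (𝓡 n) ∞ L]

/-- A field of endomorphisms of `ξ` is smooth if it maps smooth sections of `ξ` to smooth
sections of `ξ`. -/
def SmoothEnd {ξ : (x : L) → Submodule ℝ (TangentSpace (𝓡 n) x)}
    (A : (x : L) → Module.End ℝ (ξ x)) : Prop :=
  ∀ V : VField n L, SmoothField V → TangentTo ξ V → SmoothField (act A V)

/-- `ξ` is a smooth distribution of codimension one: locally it is the kernel of a nowhere
vanishing smooth one-form. -/
def SmoothCodimOne (ξ : (x : L) → Submodule ℝ (TangentSpace (𝓡 n) x)) : Prop :=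
  ∀ x : L, ∃ U : Set L, IsOpen U ∧ x ∈ U ∧ ∃ θ : OneForm n L, SmoothFormOn θ U ∧
    ∀ y ∈ U, θ y ≠ 0 ∧ ∀ v : TangentSpace (𝓡 n) y, v ∈ ξ y ↔ θ y v = 0

/-- `ξ` is integrable (involutive). -/
def Involutive (ξ : (x : L) → Submodule ℝ (TangentSpace (𝓡 n) x)) : Prop :=
  ∀ V W : VField n L, SmoothField V → SmoothField W → TangentTo ξ V → TangentTo ξ W →
    TangentTo ξ (lie V W)

/-- `(ξ, J)` is a Levi flat structure: `ξ` is a smooth integrable distribution of codimension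
one and `J` is a smooth complex structure on `ξ` which is integrable along the leaves, that is,
whose Nijenhuis tensor vanishes. -/
structure IsLeviFlat (F : EndoDistribution n L) : Prop where
  codim_one : SmoothCodimOne F.ξ
  involutive : Involutive F.ξ
  smooth_J : SmoothEnd F.J
  J_sq : ∀ x, F.J x * F.J x = -1
  integrable : ∀ V W : VField n L, SmoothField V → SmoothField W →
    TangentTo F.ξ V → TangentTo F.ξ W → nijenhuis lie (act F.J) V W = 0

/-- A DGLA defining couple `(γ, X)` for the distribution `ξ`. -/
structure DefiningCouple (ξ : (x : L) → Submodule ℝ (TangentSpace (𝓡 n) x)) where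
  γ : OneForm n L
  X : VField n L
  smooth_γ : SmoothFormOn γ univ
  smooth_X : SmoothField X
  ker_γ : ∀ (x : L) (v : TangentSpace (𝓡 n) x), v ∈ ξ x ↔ γ x v = 0
  γ_X : ∀ x, γ x (X x) = 1

/-- A diffeomorphism `Φ` of `L` is an isomorphism from `(ξ, J)` to `(ξ', J')`. -/
def IsIsoBy (Φ : Diffeomorph (𝓡 n) (𝓡 n) L L ∞) (F G : EndoDistribution n L) : Prop :=
  (∀ (x : L) (v : TangentSpace (𝓡 n) x),
    v ∈ F.ξ x ↔ mfderiv (𝓡 n) (𝓡 n) Φ x v ∈ G.ξ (Φ x)) ∧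
  ∀ (x : L) (v : F.ξ x) (w : G.ξ (Φ x)),
    (w : TangentSpace (𝓡 n) (Φ x)) = mfderiv (𝓡 n) (𝓡 n) Φ x (v : TangentSpace (𝓡 n) x) →
      ((G.J (Φ x) w : G.ξ (Φ x)) : TangentSpace (𝓡 n) (Φ x)) =
        mfderiv (𝓡 n) (𝓡 n) Φ x ((F.J x v : F.ξ x) : TangentSpace (𝓡 n) x)

/-- `(ξ, J)` and `(ξ', J')` are related by a diffeomorphism of `L`. -/
def Isomorphic (F G : EndoDistribution n L) : Prop :=
  ∃ Φ : Diffeomorph (𝓡 n) (𝓡 n) L L ∞, IsIsoBy Φ F G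

end Structures

/-! ### Maurer-Cartan pairs -/

section MaurerCartan

variable {n : ℕ} {L : Type*} [TopologicalSpace L] [ChartedSpace (EuclideanSpace ℝ (Fin n)) L]
  [IsManifold (𝓡 n) ∞ L] {F : EndoDistribution n L}

/-- `𝒵¹(L)`: the smooth one-forms `α` with `ι_X α = 0`. -/
def ZOne (c : DefiningCouple F.ξ) : Type _ :=
  {α : OneForm n L // SmoothFormOn α univ ∧ ∀ x, α x (c.X x) = 0}

/-- `Λ^{0,1}_J(ξ) ⊗ ξ`: the smooth `ξ`-valued one-forms `S` on `ξ` with `S (J v) = - J (S v)`. -/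
def ZeroOneForm (F : EndoDistribution n L) : Type _ :=
  {S : (x : L) → Module.End ℝ (F.ξ x) // SmoothEnd S ∧ ∀ x, S x * F.J x = -(F.J x * S x)}

/-- `ω_α (V) = V - α (V) X`. -/
def omega (c : DefiningCouple F.ξ) (α : OneForm n L) (V : VField n L) : VField n L :=
  fun x => V x - α x (V x) • c.X x

/-- `ω_α⁻¹ (V) = V + α (V) X`, the inverse of `ω_α` when `α (X) = 0`. -/
def omegaInv (c : DefiningCouple F.ξ) (α : OneForm n L) (V : VField n L) : VField n L :=
  fun x => V x + α x (V x) • c.X x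

/-- `[V, W]_α = ω_α⁻¹ [ω_α V, ω_α W]`. -/
def lieAlpha (c : DefiningCouple F.ξ) (α : OneForm n L) (V W : VField n L) : VField n L :=
  omegaInv c α (lie (omega c α V) (omega c α W))

/-- `T (V) = [V, X] - γ ([V, X]) X`. -/
def tForm (c : DefiningCouple F.ξ) (V : VField n L) : VField n L :=
  fun x => lie V c.X x - c.γ x (lie V c.X x) • c.X x

/-- `H (V) = 1/2 (T (V) + J T (J V))`. -/
def hForm (c : DefiningCouple F.ξ) (V : VField n L) : VField n L :=
  (1 / 2 : ℝ) • (tForm c V + act F.J (tForm c (act F.J V)))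

/-- `α^{0,1} (V) Z`, where `α^{0,1} (V) = 1/2 (α (V) + i α (J V))` and `i` acts on `ξ` as `J`. -/
def zeroOnePart (F : EndoDistribution n L) (α : OneForm n L) (V Z : VField n L) : VField n L :=
  fun x => (1 / 2 : ℝ) • (α x (V x) • Z x + α x (act F.J V x) • act F.J Z x)

/-- `(α^{0,1} ∧ H) (V, W)`. -/
def wedgeH (c : DefiningCouple F.ξ) (α : OneForm n L) (V W : VField n L) : VField n L :=
  zeroOnePart F α V (hForm c W) - zeroOnePart F α W (hForm c V)

/-- `δ α + 1/2 {α, α} = 0`, where `δ α = d α + {γ, α}`. -/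
def EqAlpha (c : DefiningCouple F.ξ) (α : OneForm n L) : Prop :=
  ∀ V W : VField n L, SmoothField V → SmoothField W → ∀ x,
    (extD α V W x + formBracket c.X c.γ α V W x) + (1 / 2) * formBracket c.X α α V W x = 0

/-- `∂̄_J^α S + 1/2 [[S, S]]_α = - α^{0,1} ∧ H`, all operators being those of `[·,·]_α`. The
first equation makes `[·,·]_α` a bracket on the vector fields tangent to `ξ`. -/
def EqS (c : DefiningCouple F.ξ) (α : OneForm n L) (S : (x : L) → Module.End ℝ (F.ξ x)) : Prop :=
  ∀ V W : VField n L, SmoothField V → SmoothField W → TangentTo F.ξ V → TangentTo F.ξ W →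
    dbarEnd (lieAlpha c α) (act F.J) (act S) V W
      + (1 / 2 : ℝ) • sDoubleBracket (lieAlpha c α) (act F.J) (act S) V W = -wedgeH c α V W

/-- The set `𝔐ℭ_{δ,ℒℱ}(L)` of solutions of the two equations. -/
def MC (c : DefiningCouple F.ξ) : Set (ZOne c × ZeroOneForm F) :=
  {p | EqAlpha c p.1.1 ∧ EqS c p.1.1 p.2.1}

/-- `I + S` is invertible, so that `(I + S) J (I + S)⁻¹` makes sense. -/
def InvertibleS (S : ZeroOneForm F) : Prop := ∀ x, IsUnit (1 + S.1 x)

/-- The solutions `(α, S)` which define a deformed structure. -/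
abbrev MCPair (c : DefiningCouple F.ξ) : Type _ :=
  {p : ZOne c × ZeroOneForm F // p ∈ MC c ∧ InvertibleS p.2}

end MaurerCartan

/-! ### The deformed structures, and the gauge action -/

section Deformations

variable {n : ℕ} {L : Type*} [TopologicalSpace L] [ChartedSpace (EuclideanSpace ℝ (Fin n)) L]
  [IsManifold (𝓡 n) ∞ L] {F : EndoDistribution n L}

/-- The projection of the tangent space onto `ξ` along `X`. Its restriction to
`ξ_α = ker (γ + α)` is `ω_α⁻¹ : ξ_α → ξ`. -/
def proj (c : DefiningCouple F.ξ) (x : L) : TangentSpace (𝓡 n) x →ₗ[ℝ] F.ξ x where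
  toFun v := ⟨v - c.γ x v • c.X x, by
    rw [c.ker_γ]
    simp [c.γ_X]⟩
  map_add' v w := by
    apply Subtype.ext
    simp only [map_add, add_smul, Submodule.coe_add]
    abel
  map_smul' r v := by
    apply Subtype.ext
    simp only [map_smul, smul_eq_mul, mul_smul, RingHom.id_apply, Submodule.coe_smul, smul_sub]

/-- `ω_α` on `ξ_x`, with values in the tangent space. -/
def omegaAt (c : DefiningCouple F.ξ) (α : OneForm n L) (x : L) :
    F.ξ x →ₗ[ℝ] TangentSpace (𝓡 n) x where
  toFun v := (v : TangentSpace (𝓡 n) x) - α x (v : TangentSpace (𝓡 n) x) • c.X x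
  map_add' v w := by
    simp only [Submodule.coe_add, map_add, add_smul]
    abel
  map_smul' r v := by
    simp only [Submodule.coe_smul, map_smul, smul_eq_mul, mul_smul, RingHom.id_apply, smul_sub]

/-- `(I + S) J (I + S)⁻¹`. -/
def twist (S : ZeroOneForm F) (x : L) : Module.End ℝ (F.ξ x) :=
  (1 + S.1 x) * F.J x * Ring.inverse (1 + S.1 x)

/-- `ω_α (I + S) J (I + S)⁻¹ ω_α⁻¹`, precomposed with the projection along `X`. -/
def jAlpha (c : DefiningCouple F.ξ) (α : ZOne c) (S : ZeroOneForm F) (x : L) :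
    Module.End ℝ (TangentSpace (𝓡 n) x) :=
  omegaAt c α.1 x ∘ₗ twist S x ∘ₗ proj c x

theorem jAlpha_mem (c : DefiningCouple F.ξ) (α : ZOne c) (S : ZeroOneForm F) (x : L)
    (v : TangentSpace (𝓡 n) x) :
    jAlpha c α S x v ∈ LinearMap.ker ((c.γ x + α.1 x : TangentSpace (𝓡 n) x →L[ℝ] ℝ) :
      TangentSpace (𝓡 n) x →ₗ[ℝ] ℝ) := by
  have h := (c.ker_γ x _).1 (twist S x (proj c x v)).2
  simp [jAlpha, omegaAt, h, c.γ_X, α.2.2]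

/-- The structure `(ξ_α, J_α)` defined by `(α, S)`: `ξ_α = ker (γ + α)` and
`J_α = ω_α (I + S) J (I + S)⁻¹ ω_α⁻¹`. -/
def deform (c : DefiningCouple F.ξ) (p : ZOne c × ZeroOneForm F) : EndoDistribution n L where
  ξ x := LinearMap.ker ((c.γ x + p.1.1 x : TangentSpace (𝓡 n) x →L[ℝ] ℝ) :
      TangentSpace (𝓡 n) x →ₗ[ℝ] ℝ)
  J x := (jAlpha c p.1 p.2 x).restrict (fun v _ => jAlpha_mem c p.1 p.2 x v)

/-- The structure `(ξ', J')` is close to `(ξ, J)`: the distribution `ξ'` is transverse to `X`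
and, for `π : ξ' → ξ` the projection along `X`, the map `J π + π J' : ξ' → ξ` is injective, that
is, `det (J + π J' π⁻¹) ≠ 0`. -/
def CloseTo (c : DefiningCouple F.ξ) (G : EndoDistribution n L) : Prop :=
  ∀ x, c.X x ∉ G.ξ x ∧ ∀ v : G.ξ x,
    F.J x (proj c x (v : TangentSpace (𝓡 n) x))
      + proj c x ((G.J x v : G.ξ x) : TangentSpace (𝓡 n) x) = 0 → v = 0

/-- The space of deformations: the Levi flat structures on `L` that are close to `(ξ, J)`. -/
abbrev Deformation (c : DefiningCouple F.ξ) : Type _ :=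
  {G : EndoDistribution n L // IsLeviFlat G ∧ CloseTo c G}

/-- The pull-back `Φ^* (γ + α)`. -/
def pullForm (c : DefiningCouple F.ξ) (Φ : Diffeomorph (𝓡 n) (𝓡 n) L L ∞) (α : ZOne c) :
    OneForm n L :=
  fun x => (c.γ (Φ x) + α.1 (Φ x)).comp (mfderiv (𝓡 n) (𝓡 n) Φ x)

/-- `χ(Φ)(α) = (Φ^* (γ + α) (X))⁻¹ Φ^* (γ + α) - γ`. -/
def chi (c : DefiningCouple F.ξ) (Φ : Diffeomorph (𝓡 n) (𝓡 n) L L ∞) (α : ZOne c) :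
    OneForm n L :=
  fun x => (pullForm c Φ α x (c.X x))⁻¹ • pullForm c Φ α x - c.γ x

/-- `ω_β⁻¹ Φ_*⁻¹ J_α Φ_* ω_β` on `ξ`, for `β = χ(Φ)(α)` and `J_α` the complex structure defined
by `(α, S)`. -/
def pulledJ (c : DefiningCouple F.ξ) (Φ : Diffeomorph (𝓡 n) (𝓡 n) L L ∞)
    (p : ZOne c × ZeroOneForm F) (x : L) : Module.End ℝ (F.ξ x) :=
  proj c x ∘ₗ ((mfderiv (𝓡 n) (𝓡 n) Φ x).inverse :
      TangentSpace (𝓡 n) (Φ x) →ₗ[ℝ] TangentSpace (𝓡 n) x) ∘ₗ jAlpha c p.1 p.2 (Φ x) ∘ₗ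
    (mfderiv (𝓡 n) (𝓡 n) Φ x : TangentSpace (𝓡 n) x →ₗ[ℝ] TangentSpace (𝓡 n) (Φ x)) ∘ₗ
      omegaAt c (chi c Φ p.1) x

/-- The action of `Φ` on `(α, S)` is defined: `Φ^* (γ + α) (X)` vanishes nowhere, and
`J + ω_β⁻¹ Φ_*⁻¹ J_α Φ_* ω_β` is invertible, where `β = χ(Φ)(α)`. -/
def GaugeDefined (c : DefiningCouple F.ξ) (Φ : Diffeomorph (𝓡 n) (𝓡 n) L L ∞)
    (p : ZOne c × ZeroOneForm F) : Prop :=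
  ∀ x, pullForm c Φ p.1 x (c.X x) ≠ 0 ∧ IsUnit (F.J x + pulledJ c Φ p x)

/-- `S_{χ(Φ)(α)}`: the `(0,1)`-form `Q` with `(I + Q) J (I + Q)⁻¹ = J'` for
`J' = ω_β⁻¹ Φ_*⁻¹ J_α Φ_* ω_β`, that is, `Q = (J + J')⁻¹ (J - J')`. -/
def gaugeS (c : DefiningCouple F.ξ) (Φ : Diffeomorph (𝓡 n) (𝓡 n) L L ∞)
    (p : ZOne c × ZeroOneForm F) (x : L) : Module.End ℝ (F.ξ x) :=
  Ring.inverse (F.J x + pulledJ c Φ p x) * (F.J x - pulledJ c Φ p x)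

/-- `Φ` takes `(α, S)` to `(β, Q) = (χ(Φ)(α), S_{χ(Φ)(α)})`. -/
def GaugeBy (c : DefiningCouple F.ξ) (Φ : Diffeomorph (𝓡 n) (𝓡 n) L L ∞)
    (p q : ZOne c × ZeroOneForm F) : Prop :=
  GaugeDefined c Φ p ∧ q.1.1 = chi c Φ p.1 ∧ q.2.1 = gaugeS c Φ p

/-- Gauge equivalence of solutions. -/
def GaugeEquiv (c : DefiningCouple F.ξ) (p q : MCPair c) : Prop :=
  ∃ Φ : Diffeomorph (𝓡 n) (𝓡 n) L L ∞, GaugeBy c Φ p.1 q.1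

/-- The moduli space of deformations of `(ξ, J)`: the deformations modulo the diffeomorphisms
of `L`. -/
def ModuliSpace (c : DefiningCouple F.ξ) : Type _ :=
  Quot (fun G G' : Deformation c => Isomorphic G.1 G'.1)

/-- The solutions of the Maurer-Cartan equations modulo gauge equivalence. -/
def MCQuotient (c : DefiningCouple F.ξ) : Type _ := Quot (GaugeEquiv c)

end Deformations

end LeviFlat

end

/-! A hyperplane field transverse to `X` is the same thing as a one-form θ with θ(X) = 1. It is
involutive exactly when dθ + ½{θ,θ} = 0 (`involutive_iff_curvature`): this two-form is killed by `X`
and equals −θ[V,W] on fields tangent to ker θ. Passing from θ = γ, where it vanishes, to θ = γ + α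
changes it by δα + ½{α,α}, which gives the first equation.

Next, ω_α carries [·,·]_α to the Lie bracket and K = (I+S)J(I+S)⁻¹ to the deformed complex
structure. So integrability of the latter means N_K = 0 for the bracket [·,·]_α on sections of ξ. A
formal identity (`nijenhuis_twist`) reads 4(∂̄S + ½[[S,S]])(V,W) = N_J(V,W) − (I−S)
N_K((I+S)V,(I+S)W). Since [V,W]_α = [V,W] − α(W)T(V) + α(V)T(W) and J is integrable for the Lie
bracket, N_J = −4 α^{0,1}∧H (`nijenhuis_lieAlpha`). As I+S and I−S are invertible, N_K = 0 is the
second equation (`eqS_iff_nijenhuis`).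

Conversely, α is read off from the normalised form of the distribution, and S is recovered from K as
(J+K)⁻¹(J−K). This matches the S with SJ = −JS and I+S invertible with the complex structures K for
which J+K is invertible, hence the bijection `bijOn_deform`. Smoothness of the inverses involved
comes from Cramer's rule.

The gauge formulas express that the structure of (β,Q) is the pull-back by Φ of the structure of
(α,S). Levi flatness is natural under diffeomorphisms, and where the action is defined the pull-back
is close to (ξ,J), so it comes from a unique solution. Thus the gauge action is isomorphism of
structures read through the bijection (`gaugeBy_iff_isIsoBy`). -/

noncomputable section
namespace LeviFlat

/-! ### Smooth fields, Lie brackets and derivatives -/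

section Calculus

variable {n : ℕ} {L : Type*} [TopologicalSpace L] [ChartedSpace (EuclideanSpace ℝ (Fin n)) L]
  [IsManifold (𝓡 n) ∞ L] {V V' W W' : VField n L} {f g : L → ℝ}

theorem SmoothField.add (hV : SmoothField V) (hW : SmoothField W) : SmoothField (V + W) :=
  ContMDiff.add_section hV hW

theorem SmoothField.sub (hV : SmoothField V) (hW : SmoothField W) : SmoothField (V - W) :=
  ContMDiff.sub_section hV hW

theorem SmoothField.neg (hV : SmoothField V) : SmoothField (-V) :=
  ContMDiff.neg_section hV

theorem SmoothField.smul (hf : ContMDiff (𝓡 n) 𝓘(ℝ, ℝ) ∞ f) (hV : SmoothField V) :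
    SmoothField (f • V) :=
  ContMDiff.smul_section hf hV

theorem SmoothField.const_smul (a : ℝ) (hV : SmoothField V) : SmoothField (a • V) :=
  ContMDiff.const_smul_section hV

theorem smoothField_zero : SmoothField (0 : VField n L) :=
  Bundle.contMDiff_zeroSection ℝ (TangentSpace (𝓡 n) : L → Type _)

theorem SmoothField.mdifferentiableAt (hV : SmoothField V) (x : L) :
    MDifferentiableAt (𝓡 n) (𝓡 n).tangent (fun y => (⟨y, V y⟩ : TangentBundle (𝓡 n) L)) x :=
  (ContMDiff.contMDiffAt hV).mdifferentiableAt (by simp)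

theorem SmoothField.lie (hV : SmoothField V) (hW : SmoothField W) :
    SmoothField (LeviFlat.lie V W) := by
  have : IsManifold (𝓡 n) (((⊤ : ℕ∞) : ℕ∞ω) + 1) L := by
    simpa using (inferInstance : IsManifold (𝓡 n) ∞ L)
  have : IsManifold (𝓡 n) (minSmoothness ℝ 2) L := by
    rw [minSmoothness_of_isRCLikeNormedField]
    infer_instance
  exact ContDiff.mlieBracket_vectorField (m := ⊤) (n := ⊤) hV hW (by simp)

theorem lie_swap (V W : VField n L) : lie V W = -lie W V := VectorField.mlieBracket_swap

theorem lie_add_left (hV : SmoothField V) (hV' : SmoothField V') :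
    lie (V + V') W = lie V W + lie V' W :=
  funext fun x => VectorField.mlieBracket_add_left (hV.mdifferentiableAt x) (hV'.mdifferentiableAt x)

theorem lie_add_right (hW : SmoothField W) (hW' : SmoothField W') :
    lie V (W + W') = lie V W + lie V W' :=
  funext fun x =>
    VectorField.mlieBracket_add_right (hW.mdifferentiableAt x) (hW'.mdifferentiableAt x)

theorem lie_smul_right (hf : ContMDiff (𝓡 n) 𝓘(ℝ, ℝ) ∞ f) (hW : SmoothField W) (x : L) :
    lie V (f • W) x = dirDeriv V f x • W x + f x • lie V W x :=
  VectorField.mlieBracket_smul_right (hf.contMDiffAt.mdifferentiableAt (by simp))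
    (hW.mdifferentiableAt x)

theorem lie_smul_left (hf : ContMDiff (𝓡 n) 𝓘(ℝ, ℝ) ∞ f) (hV : SmoothField V) (x : L) :
    lie (f • V) W x = -dirDeriv W f x • V x + f x • lie V W x := by
  rw [neg_smul, ← neg_smul]
  exact VectorField.mlieBracket_smul_left (W := W)
    (hf.contMDiffAt.mdifferentiableAt (by simp)) (hV.mdifferentiableAt x)

theorem lie_self (V : VField n L) : lie V V = 0 := by
  have h : lie V V + lie V V = 0 := by
    nth_rw 1 [lie_swap]
    exact neg_add_cancel _
  rw [← two_smul ℝ] at h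
  exact (smul_eq_zero.1 h).resolve_left two_ne_zero

theorem dirDeriv_add (hf : ContMDiff (𝓡 n) 𝓘(ℝ, ℝ) ∞ f) (hg : ContMDiff (𝓡 n) 𝓘(ℝ, ℝ) ∞ g)
    (V : VField n L) (x : L) :
    dirDeriv V (fun y => f y + g y) x = dirDeriv V f x + dirDeriv V g x := by
  have := mfderiv_add (hf.contMDiffAt.mdifferentiableAt (x := x) (by simp))
    (hg.contMDiffAt.mdifferentiableAt (x := x) (by simp))
  exact congrArg (fun A => A (V x)) this

theorem dirDeriv_add_left (V W : VField n L) (f : L → ℝ) (x : L) :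
    dirDeriv (V + W) f x = dirDeriv V f x + dirDeriv W f x :=
  map_add (mfderiv (𝓡 n) 𝓘(ℝ, ℝ) f x) _ _

theorem dirDeriv_smul_left (g : L → ℝ) (V : VField n L) (f : L → ℝ) (x : L) :
    dirDeriv (g • V) f x = g x * dirDeriv V f x :=
  map_smul (mfderiv (𝓡 n) 𝓘(ℝ, ℝ) f x) _ _

theorem dirDeriv_const (V : VField n L) (a : ℝ) (x : L) :
    dirDeriv V (fun _ => a) x = 0 := by
  simp only [dirDeriv, mfderiv_const]
  rfl

theorem SmoothFormOn.contMDiff {θ : OneForm n L} (hθ : SmoothFormOn θ univ)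
    (hV : SmoothField V) : ContMDiff (𝓡 n) 𝓘(ℝ, ℝ) ∞ (fun x => θ x (V x)) :=
  contMDiffOn_univ.1 (hθ V hV)

theorem SmoothFormOn.add {θ η : OneForm n L} {U : Set L} (hθ : SmoothFormOn θ U)
    (hη : SmoothFormOn η U) : SmoothFormOn (θ + η) U :=
  fun V hV => (hθ V hV).add (hη V hV)

end Calculus

/-! ### Involutivity as a curvature equation -/

section Frobenius

variable {n : ℕ} {L : Type*} [TopologicalSpace L] [ChartedSpace (EuclideanSpace ℝ (Fin n)) L]
  [IsManifold (𝓡 n) ∞ L] {X : VField n L} {θ η : OneForm n L}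

/-- The two-form `dθ + 1/2 {θ, θ}`. -/
def curvature (X : VField n L) (θ : OneForm n L) (V W : VField n L) (x : L) : ℝ :=
  extD θ V W x + (1 / 2) * formBracket X θ θ V W x

/-- The bracket {·,·} is symmetric, so the cross terms of ½{θ+η, θ+η} add up to {θ,η}. For θ = γ and
η = α the increment is the left side of the first Maurer-Cartan equation. -/
theorem curvature_add (hθ : SmoothFormOn θ univ) (hη : SmoothFormOn η univ)
    {V W : VField n L} (hV : SmoothField V) (hW : SmoothField W) (x : L) :
    curvature X (θ + η) V W x = curvature X θ V W x +
      ((extD η V W x + formBracket X θ η V W x) + (1 / 2) * formBracket X η η V W x) := by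
  simp only [curvature, extD, formBracket, lieDer, Pi.add_apply, add_apply,
    dirDeriv_add (hθ.contMDiff hV) (hη.contMDiff hV),
    dirDeriv_add (hθ.contMDiff hW) (hη.contMDiff hW)]
  ring

/-- The kernel of a one-form `θ` with `θ (X) = 1` is involutive if and only if
`dθ + 1/2 {θ, θ} = 0`. -/
theorem involutive_iff_curvature (hX : SmoothField X) (hθ : SmoothFormOn θ univ)
    (hθX : ∀ x, θ x (X x) = 1) {ξ : (x : L) → Submodule ℝ (TangentSpace (𝓡 n) x)}
    (hξ : ∀ x v, v ∈ ξ x ↔ θ x v = 0) :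
    Involutive ξ ↔ ∀ V W : VField n L, SmoothField V → SmoothField W →
      ∀ x, curvature X θ V W x = 0 := by
  constructor
  · intro h V W hV hW x
    set f : L → ℝ := fun y => θ y (V y) with hf
    set g : L → ℝ := fun y => θ y (W y) with hg
    have sf : ContMDiff (𝓡 n) 𝓘(ℝ, ℝ) ∞ f := hθ.contMDiff hV
    have sg : ContMDiff (𝓡 n) 𝓘(ℝ, ℝ) ∞ g := hθ.contMDiff hW
    have sfX := SmoothField.smul sf hX
    have sgX := SmoothField.smul sg hX
    obtain ⟨V₀, hV₀⟩ : ∃ V₀, V₀ = V - f • X := ⟨_, rfl⟩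
    obtain ⟨W₀, hW₀⟩ : ∃ W₀, W₀ = W - g • X := ⟨_, rfl⟩
    have sV : SmoothField V₀ := hV₀ ▸ hV.sub sfX
    have sW : SmoothField W₀ := hW₀ ▸ hW.sub sgX
    have tV : TangentTo ξ V₀ := fun y => by
      rw [hξ, hV₀]; simp [hf, hθX]
    have tW : TangentTo ξ W₀ := fun y => by
      rw [hξ, hW₀]; simp [hg, hθX]
    have eV : V = V₀ + f • X := by rw [hV₀]; abel
    have eW : W = W₀ + g • X := by rw [hW₀]; abel
    have h0 := (hξ _ _).1 (h V₀ W₀ sV sW tV tW x)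
    have hff : ∀ y, θ y ((V₀ + f • X) y) = f y := fun y => by rw [← eV]
    have hgg : ∀ y, θ y ((W₀ + g • X) y) = g y := fun y => by rw [← eW]
    -- From here `f` and `g` are opaque functions, known only through `hff` and `hgg`; otherwise
    -- substituting V = V₀ + fX would be circular.
    clear_value f g
    subst eV eW
    simp only [curvature, extD, formBracket, lieDer, hff, hgg]
    simp only [dirDeriv_add_left,
      dirDeriv_smul_left, lie_add_left sV sfX, lie_add_right sW sgX, lie_add_right sV sfX,
      Pi.add_apply, map_add, map_smul, lie_smul_left sf hX, lie_smul_right sg hX,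
      lie_smul_right sf hX, hθX, h0, smul_eq_mul, lie_self, Pi.zero_apply, map_zero]
    rw [lie_swap V₀ X]
    simp only [Pi.neg_apply, map_neg]
    ring
  · intro h V W hV hW tV tW x
    have h1 := h V W hV hW x
    have e1 : ∀ y, θ y (V y) = 0 := fun y => (hξ _ _).1 (tV y)
    have e2 : ∀ y, θ y (W y) = 0 := fun y => (hξ _ _).1 (tW y)
    simp only [curvature, extD, formBracket, lieDer, e1, e2, dirDeriv_const] at h1
    rw [hξ]
    linarith

end Frobenius
end LeviFlat
end

noncomputable section
namespace LeviFlat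

/-! ### Smoothness of the inverse of a field of endomorphisms -/

section Inverse

variable {n : ℕ} {L : Type*} [TopologicalSpace L] [ChartedSpace (EuclideanSpace ℝ (Fin n)) L]
  [IsManifold (𝓡 n) ∞ L]

/-- Near a given point, a field which is smooth there agrees with a globally smooth one. -/
theorem exists_smoothField_eventuallyEq [T2Space L] {V : VField n L} {U : Set L} (hU : IsOpen U)
    (hV : ContMDiffOn (𝓡 n) (𝓡 n).tangent ∞ (fun x => (⟨x, V x⟩ : TangentBundle (𝓡 n) L)) U)
    {x : L} (hx : x ∈ U) :
    ∃ W : VField n L, SmoothField W ∧ ∀ᶠ y in nhds x, W y = V y := by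
  obtain ⟨f, hf⟩ : ∃ f : SmoothBumpFunction (𝓡 n) x, tsupport f ⊆ U := by
    obtain ⟨f, -, hf⟩ := (SmoothBumpFunction.nhds_basis_tsupport (I := 𝓡 n) x).mem_iff.1
      (hU.mem_nhds hx)
    exact ⟨f, hf⟩
  refine ⟨(f : L → ℝ) • V, ContMDiffOn.smul_section_of_tsupport f.contMDiff.contMDiffOn hU hf hV, ?_⟩
  filter_upwards [f.eventuallyEq_one] with y hy
  simp only [Pi.smul_apply', hy, Pi.one_apply, one_smul]

theorem ContMDiffAt.matrix_det {m : ℕ} {x : L} {M : L → Matrix (Fin m) (Fin m) ℝ}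
    (h : ∀ i j, ContMDiffAt (𝓡 n) 𝓘(ℝ, ℝ) ∞ (fun y => M y i j) x) :
    ContMDiffAt (𝓡 n) 𝓘(ℝ, ℝ) ∞ (fun y => (M y).det) x := by
  simp only [Matrix.det_apply']
  exact contMDiffAt_finsetSum fun σ _ =>
    contMDiffAt_const.mul (contMDiffAt_finsetProd fun i _ => h _ _)

/-- If a pointwise invertible field of endomorphisms preserves smoothness of vector fields, then so
does its inverse. -/
theorem smoothField_of_smoothField_apply [T2Space L]
    {A : (x : L) → Module.End ℝ (TangentSpace (𝓡 n) x)}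
    (hA : ∀ V : VField n L, SmoothField V → SmoothField fun x => A x (V x))
    (hinj : ∀ x v, A x v = 0 → v = 0) {W : VField n L}
    (hW : SmoothField fun x => A x (W x)) : SmoothField W := by
  intro x
  let e := trivializationAt (EuclideanSpace ℝ (Fin n)) (TangentSpace (𝓡 n) : L → Type _) x
  let b := (EuclideanSpace.basisFun (Fin n) ℝ).toBasis
  have hx : x ∈ e.baseSet := FiberBundle.mem_baseSet_trivializationAt' x
  -- The hypothesis `hA` speaks only of globally smooth fields, so the local frame is replaced by
  -- global fields agreeing with it near `x`.
  have hloc : ∀ j, ∃ E : VField n L, SmoothField E ∧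
      ∀ᶠ y in nhds x, E y = e.localFrame b j y := fun j =>
    exists_smoothField_eventuallyEq e.open_baseSet
      (e.contMDiffOn_localFrame_baseSet ∞ b j) hx
  choose E sE hE using hloc
  let co (i : Fin n) (V : VField n L) (y : L) : ℝ := e.localFrameCoeff (𝓡 n) b i y (V y)
  have hco : ∀ i V, SmoothField V → ContMDiffAt (𝓡 n) 𝓘(ℝ, ℝ) ∞ (co i V) x := fun i V hV =>
    contMDiffAt_localFrameCoeff b hx (hV x) i
  let M (y : L) : Matrix (Fin n) (Fin n) ℝ := fun i j => co i (fun z => A z (E j z)) y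
  let B (y : L) : Fin n → ℝ := fun i => co i (fun z => A z (W z)) y
  have sM : ∀ i j, ContMDiffAt (𝓡 n) 𝓘(ℝ, ℝ) ∞ (fun y => M y i j) x := fun i j =>
    hco i _ (hA _ (sE j))
  have sB : ∀ i, ContMDiffAt (𝓡 n) 𝓘(ℝ, ℝ) ∞ (fun y => B y i) x := fun i => hco i _ hW
  have hframe : ∀ᶠ y in nhds x, y ∈ e.baseSet ∧ ∀ j, E j y = e.localFrame b j y :=
    Filter.Eventually.and (e.open_baseSet.mem_nhds hx) (Filter.eventually_all.2 hE)
  -- The frame expansion is available for sections, so the vector `v` is extended by zero to a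
  -- (discontinuous) section.
  have hsum : ∀ y ∈ e.baseSet, ∀ v : TangentSpace (𝓡 n) y,
      v = ∑ i, e.localFrameCoeff (𝓡 n) b i y v • e.localFrame b i y := fun y hy v => by
    classical
    have := Bundle.Trivialization.eq_sum_localFrameCoeff_smul (I := 𝓡 n) (b := b)
      (s := Function.update (0 : VField n L) y v) hy
    simpa using this
  have hMw : ∀ᶠ y in nhds x, (M y).mulVec (fun i => co i W y) = B y := by
    filter_upwards [hframe] with y hy
    ext i
    simp only [Matrix.mulVec, dotProduct, M, B, co]
    conv_rhs => rw [hsum y hy.1 (W y)]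
    simp only [map_sum, map_smul, smul_eq_mul, hy.2, mul_comm]
  have hdet : ∀ᶠ y in nhds x, (M y).det ≠ 0 := by
    filter_upwards [hframe] with y hy h0
    obtain ⟨w, hw0, hw⟩ := Matrix.exists_mulVec_eq_zero_iff.2 h0
    have hv : A y (∑ j, w j • e.localFrame b j y) = 0 := by
      rw [hsum y hy.1 (A y _)]
      refine Finset.sum_eq_zero fun i _ => ?_
      have := congrFun hw i
      simp only [Matrix.mulVec, dotProduct, M, co, hy.2, Pi.zero_apply] at this
      simp only [map_sum, map_smul, smul_eq_mul]
      rw [Finset.sum_congr rfl fun j _ => mul_comm (w j) _, this, zero_smul]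
    have := hinj y _ hv
    have hli := ((e.isLocalFrameOn_localFrame_baseSet (𝓡 n) ∞ b).linearIndependent hy.1)
    exact hw0 (funext (Fintype.linearIndependent_iff.1 hli w this))
  refine (contMDiffAt_iff_localFrameCoeff b hx).2 fun i => ?_
  -- Cramer's rule for the system M w = B satisfied by the coefficients w of `W` in the frame; it
  -- exhibits them as quotients of smooth functions.
  have key : ∀ᶠ y in nhds x, co i W y = ((M y).updateCol i (B y)).det / (M y).det := by
    filter_upwards [hMw, hdet] with y hy hd
    rw [eq_div_iff hd, ← Matrix.cramer_apply, ← hy]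
    simp only [Matrix.cramer_eq_adjugate_mulVec, Matrix.mulVec_mulVec, Matrix.adjugate_mul]
    simp [Matrix.smul_mulVec, mul_comm]
  refine ContMDiffAt.congr_of_eventuallyEq ?_ key
  have h2 : ContMDiffAt (𝓡 n) 𝓘(ℝ, ℝ) ∞ (fun y => ((M y).updateCol i (B y)).det) x := by
    refine ContMDiffAt.matrix_det fun k j => ?_
    by_cases hj : j = i
    · subst hj
      simpa using sB k
    · simpa [Matrix.updateCol_ne hj] using sM k j
  exact h2.div₀ (ContMDiffAt.matrix_det sM) hdet.self_of_nhds

end Inverse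
end LeviFlat
end

noncomputable section
namespace LeviFlat

/-! ### Formal identities for the Nijenhuis tensor -/

section Algebra

variable {g h : Type*} [AddCommGroup g] [Module ℝ g] [AddCommGroup h] [Module ℝ h]

section Map

variable {br : g → g → g} {J S : g → g} {br' : h → h → h} {J' S' : h → h} (φ : g →ₗ[ℝ] h)
  (hbr : ∀ V W, φ (br V W) = br' (φ V) (φ W)) (hJ : ∀ V, φ (J V) = J' (φ V))
  (hS : ∀ V, φ (S V) = S' (φ V))

-- Naturality under a linear map intertwining the data. It serves to compare sections of a
-- distribution with arbitrary vector fields, and to transport along ω_α and along pull-back by a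
-- diffeomorphism.
include hbr hJ in
theorem map_nijenhuis (V W : g) :
    φ (nijenhuis br J V W) = nijenhuis br' J' (φ V) (φ W) := by
  simp only [nijenhuis, map_sub, hbr, hJ]

include hbr hJ hS in
theorem map_dbarEnd (V W : g) :
    φ (dbarEnd br J S V W) = dbarEnd br' J' S' (φ V) (φ W) := by
  simp only [dbarEnd, dbarVec, map_sub, map_add, map_smul, hbr, hJ, hS,
    map_nijenhuis φ hbr hJ]

include hbr hJ hS in
theorem map_sDoubleBracket (V W : g) :
    φ (sDoubleBracket br J S V W) = sDoubleBracket br' J' S' (φ V) (φ W) := by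
  simp only [sDoubleBracket, sBracket, map_sub, map_add, map_smul, hbr, hJ, hS,
    map_nijenhuis φ hbr hJ]

end Map

variable {br : g →ₗ[ℝ] g →ₗ[ℝ] g} {J S J' : Module.End ℝ g}

/-- The Nijenhuis tensor of `J' = (I + S) J (I + S)⁻¹` in terms of `S`. -/
theorem nijenhuis_twist (hbr : ∀ a b, br a b = -br b a) (hS : ∀ a, S (J a) = -J (S a))
    (h1 : ∀ a, J' (a + S a) = J a - J (S a)) (h2 : ∀ b, S (J' b) = J' b - (J b - J (S b)))
    (V W : g) :
    (4 : ℝ) • (dbarEnd (fun a b => br a b) J S V W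
        + (1 / 2 : ℝ) • sDoubleBracket (fun a b => br a b) J S V W)
      = nijenhuis (fun a b => br a b) J V W
        + S (nijenhuis (fun a b => br a b) J' (V + S V) (W + S W))
        - nijenhuis (fun a b => br a b) J' (V + S V) (W + S W) := by
  -- `h1` removes J' from inside the brackets. In front of a bracket, `h2` turns S J' into J' −
  -- J(I−S), and this J' cancels against the subtracted tensor. What remains is a bilinear expansion
  -- in J and S.
  simp only [nijenhuis, dbarEnd, dbarVec, sDoubleBracket, sBracket, h1, map_sub, map_add,
    map_neg, h2, hS, hbr W (S V),
    hbr (J W) (S V), hbr (J W) (J (S V)), hbr W (J (S V)), LinearMap.sub_apply, LinearMap.add_apply]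
  module

end Algebra

/-! ### Pointwise linear algebra: the wedge correction and the Cayley transform -/

section Linear

variable {E : Type*} [AddCommGroup E] [Module ℝ E]

/-- The change of the Nijenhuis tensor when `-β(W) T(V) + β(V) T(W)` is added to the bracket. -/
theorem nijenhuis_add_wedge {J : Module.End ℝ E} (hJ : ∀ a, J (J a) = -a)
    (b₁ b₂ b₃ b₄ tV tW tJV tJW : E) (aV aW aJV aJW : ℝ) :
    (b₁ - aJW • tJV + aJV • tJW) - (b₂ - aW • tV + aV • tW) - J (b₃ - aW • tJV + aJV • tW)
        - J (b₄ - aJW • tV + aV • tJW)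
      = (b₁ - b₂ - J b₃ - J b₄)
        - (4 : ℝ) • ((1 / 2 : ℝ) • (aV • ((1 / 2 : ℝ) • (tW + J tJW))
              + aJV • J ((1 / 2 : ℝ) • (tW + J tJW)))
            - (1 / 2 : ℝ) • (aW • ((1 / 2 : ℝ) • (tV + J tJV))
              + aJW • J ((1 / 2 : ℝ) • (tV + J tJV)))) := by
  simp only [map_sub, map_add, map_smul, hJ]
  module

variable {J K S : Module.End ℝ E}

/-- The element `Q = (J + K)⁻¹ (J - K)` attached to two complex structures `J` and `K`. -/
def cayley (J K : Module.End ℝ E) : Module.End ℝ E := Ring.inverse (J + K) * (J - K)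

/-- Anticommutation gives J(I+S) = (I−S)J, and J is invertible. -/
theorem isUnit_one_sub (hJ : J * J = -1) (hS : S * J = -(J * S)) (hu : IsUnit (1 + S)) :
    IsUnit (1 - S) := by
  have hJu : IsUnit J := ⟨⟨J, -J, by simp [hJ], by simp [hJ]⟩, rfl⟩
  have : J * (1 + S) = (1 - S) * J := by rw [mul_add, sub_mul, hS]; simp
  have h2 : IsUnit ((1 - S) * J) := this ▸ hJu.mul hu
  exact (IsUnit.mul_right_iff hJu).1 h2

theorem twist_mul_self (hJ : J * J = -1) (hu : IsUnit (1 + S)) :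
    ((1 + S) * J * Ring.inverse (1 + S)) * ((1 + S) * J * Ring.inverse (1 + S)) = -1 := by
  have : ((1 + S) * J * Ring.inverse (1 + S)) * ((1 + S) * J * Ring.inverse (1 + S))
      = (1 + S) * J * (Ring.inverse (1 + S) * (1 + S)) * J * Ring.inverse (1 + S) := by
    noncomm_ring
  rw [this, Ring.inverse_mul_cancel _ hu, mul_one, mul_assoc (1 + S), hJ]
  rw [mul_neg, mul_one, neg_mul, Ring.mul_inverse_cancel _ hu]

theorem mul_one_add_of_twist (hu : IsUnit (1 + S)) (hK : K = (1 + S) * J * Ring.inverse (1 + S)) :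
    K * (1 + S) = (1 + S) * J := by
  rw [hK, mul_assoc, Ring.inverse_mul_cancel _ hu, mul_one]

/-- The terms JS and SJ cancel. The right side is invertible when J² = −I, so this links the
invertibility of I+S with that of J+K. -/
theorem add_mul_one_add_of_twist (hS : S * J = -(J * S)) (hK : K * (1 + S) = (1 + S) * J) :
    (J + K) * (1 + S) = (2 : ℝ) • J := by
  rw [add_mul, hK, mul_add, add_mul, hS, two_smul]
  simp
  abel

/-- After multiplication by I+S on the right both sides become J − S²J, because S² commutes with J.
This is the relation that lets `nijenhuis_twist` eliminate K in front of a bracket. -/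
theorem one_sub_mul_of_twist (hS : S * J = -(J * S)) (hu : IsUnit (1 + S))
    (hK : K * (1 + S) = (1 + S) * J) : (1 - S) * K = J * (1 - S) := by
  refine hu.mul_right_cancel ?_
  have h1 : J * (S * S) = S * (S * J) := by
    rw [hS, mul_neg, ← mul_assoc S, hS, neg_mul, neg_neg, mul_assoc]
  have h2 : (1 - S) * ((1 + S) * J) = J - S * (S * J) := by noncomm_ring
  have h3 : J * (1 - S) * (1 + S) = J - J * (S * S) := by noncomm_ring
  rw [mul_assoc, hK, h2, h3, h1]

theorem isUnit_add_of_twist (hJ : J * J = -1) (hS : S * J = -(J * S)) (hu : IsUnit (1 + S))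
    (hK : K * (1 + S) = (1 + S) * J) : IsUnit (J + K) := by
  have hJu : IsUnit ((2 : ℝ) • J) :=
    ⟨⟨(2 : ℝ) • J, -((1 / 2 : ℝ) • J), by simp [hJ], by simp [hJ]⟩, rfl⟩
  rw [← add_mul_one_add_of_twist hS hK] at hJu
  exact (IsUnit.mul_right_iff hu).1 hJu

theorem cayley_of_twist (hJ : J * J = -1) (hS : S * J = -(J * S)) (hu : IsUnit (1 + S))
    (hK : K * (1 + S) = (1 + S) * J) : cayley J K = S := by
  have hJK := isUnit_add_of_twist hJ hS hu hK
  have : J - K = (J + K) * S := by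
    have h1 : K * S = (1 + S) * J - K := by rw [← hK]; noncomm_ring
    rw [add_mul, h1, add_mul, hS]
    noncomm_ring
  rw [cayley, this, ← mul_assoc, Ring.inverse_mul_cancel _ hJK, one_mul]

/-- From J² = K² = −I one gets (J+K)J = K(J+K) and (J−K)J = −K(J−K); write J−K as (J+K)Q and cancel
J+K. -/
theorem cayley_anticomm (hJ : J * J = -1) (hK : K * K = -1) (hu : IsUnit (J + K)) :
    cayley J K * J = -(J * cayley J K) := by
  refine hu.mul_left_cancel ?_
  have h1 : (J + K) * J = K * (J + K) := by rw [add_mul, mul_add, hJ, hK]; abel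
  have h2 : (J + K) * cayley J K = J - K := by
    rw [cayley, ← mul_assoc, Ring.mul_inverse_cancel _ hu, one_mul]
  rw [← mul_assoc, h2, mul_neg, ← mul_assoc, h1, mul_assoc, h2, sub_mul, mul_sub, hJ, hK]
  abel

theorem mul_one_add_cayley (hu : IsUnit (J + K)) : (J + K) * (1 + cayley J K) = (2 : ℝ) • J := by
  rw [mul_add, cayley, ← mul_assoc, Ring.mul_inverse_cancel _ hu, one_mul, two_smul]
  noncomm_ring

theorem isUnit_one_add_cayley (hJ : J * J = -1) (hu : IsUnit (J + K)) :
    IsUnit (1 + cayley J K) := by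
  have hJu : IsUnit ((2 : ℝ) • J) :=
    ⟨⟨(2 : ℝ) • J, -((1 / 2 : ℝ) • J), by simp [hJ], by simp [hJ]⟩, rfl⟩
  rw [← mul_one_add_cayley hu] at hJu
  exact (IsUnit.mul_left_iff hu).1 hJu

/-- Multiplied by J+K on the left, both (I+Q)J and K(I+Q) become 2J², using (J+K)K = J(J+K). -/
theorem twist_cayley (hJ : J * J = -1) (hK : K * K = -1) (hu : IsUnit (J + K)) :
    (1 + cayley J K) * J * Ring.inverse (1 + cayley J K) = K := by
  have h3 : (1 + cayley J K) * J = K * (1 + cayley J K) := by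
    refine hu.mul_left_cancel ?_
    have h1 : (J + K) * K = J * (J + K) := by rw [add_mul, mul_add, hJ, hK]; abel
    rw [← mul_assoc, mul_one_add_cayley hu, ← mul_assoc, h1, mul_assoc, mul_one_add_cayley hu]
    simp
  rw [h3, mul_assoc, Ring.mul_inverse_cancel _ (isUnit_one_add_cayley hJ hu), mul_one]

end Linear
end LeviFlat
end

noncomputable section
namespace LeviFlat

variable {n : ℕ} {L : Type*} [TopologicalSpace L] [ChartedSpace (EuclideanSpace ℝ (Fin n)) L]

/-! ### Endomorphism fields acting on sections of a distribution -/

section Act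

variable {ξ : (x : L) → Submodule ℝ (TangentSpace (𝓡 n) x)}

theorem act_apply (A : (x : L) → Module.End ℝ (ξ x)) {V : VField n L} {x : L} (h : V x ∈ ξ x) :
    act A V x = (A x ⟨V x, h⟩ : ξ x) := dif_pos h

theorem act_mem (A : (x : L) → Module.End ℝ (ξ x)) (V : VField n L) : TangentTo ξ (act A V) := by
  intro x
  by_cases h : V x ∈ ξ x
  · rw [act_apply A h]
    exact (A x _).2
  · rw [act, dif_neg h]
    exact zero_mem _

theorem act_mul (A B : (x : L) → Module.End ℝ (ξ x)) {V : VField n L} (hV : TangentTo ξ V) :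
    act (fun x => A x * B x) V = act A (act B V) := by
  funext x
  rw [act_apply _ (hV x), act_apply _ (act_mem B V x)]
  rw [show (⟨act B V x, act_mem B V x⟩ : ξ x) = B x ⟨V x, hV x⟩ from
    Subtype.ext (act_apply B (hV x))]
  rfl

theorem act_add (A B : (x : L) → Module.End ℝ (ξ x)) {V : VField n L} (hV : TangentTo ξ V) :
    act (fun x => A x + B x) V = act A V + act B V := by
  funext x
  simp only [Pi.add_apply, act_apply _ (hV x), LinearMap.add_apply, Submodule.coe_add]

theorem act_sub (A B : (x : L) → Module.End ℝ (ξ x)) {V : VField n L} (hV : TangentTo ξ V) :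
    act (fun x => A x - B x) V = act A V - act B V := by
  funext x
  simp only [Pi.sub_apply, act_apply _ (hV x), LinearMap.sub_apply, Submodule.coe_sub]

theorem act_one {V : VField n L} (hV : TangentTo ξ V) :
    act (fun x => (1 : Module.End ℝ (ξ x))) V = V := by
  funext x
  rw [act_apply _ (hV x)]
  rfl

theorem act_neg (A : (x : L) → Module.End ℝ (ξ x)) {V : VField n L} (hV : TangentTo ξ V) :
    act (fun x => -A x) V = -act A V := by
  funext x
  simp only [Pi.neg_apply, act_apply _ (hV x), LinearMap.neg_apply, Submodule.coe_neg]

theorem act_map_add (A : (x : L) → Module.End ℝ (ξ x)) {V W : VField n L} (hV : TangentTo ξ V)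
    (hW : TangentTo ξ W) : act A (V + W) = act A V + act A W := by
  funext x
  rw [Pi.add_apply, act_apply _ (hV x), act_apply _ (hW x),
    act_apply A (V := V + W) (add_mem (hV x) (hW x)), ← Submodule.coe_add, ← map_add]
  rfl

theorem act_map_smul (A : (x : L) → Module.End ℝ (ξ x)) (a : ℝ) {V : VField n L}
    (hV : TangentTo ξ V) : act A (a • V) = a • act A V := by
  funext x
  rw [Pi.smul_apply, act_apply _ (hV x),
    act_apply A (V := a • V) (Submodule.smul_mem _ a (hV x)), ← Submodule.coe_smul, ← map_smul]
  rfl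

end Act

variable [IsManifold (𝓡 n) ∞ L]

section Tangent

variable {ξ : (x : L) → Submodule ℝ (TangentSpace (𝓡 n) x)}

/-- The smooth vector fields tangent to `ξ`. -/
def sections (ξ : (x : L) → Submodule ℝ (TangentSpace (𝓡 n) x)) : Submodule ℝ (VField n L) where
  carrier := {V | SmoothField V ∧ TangentTo ξ V}
  add_mem' hV hW := ⟨hV.1.add hW.1, fun x => add_mem (hV.2 x) (hW.2 x)⟩
  zero_mem' := ⟨smoothField_zero, fun _ => zero_mem _⟩
  smul_mem' a _ hV := ⟨hV.1.const_smul a, fun x => Submodule.smul_mem _ a (hV.2 x)⟩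

/-- The action of a smooth field of endomorphisms of `ξ` on the sections of `ξ`. -/
def actSections (A : (x : L) → Module.End ℝ (ξ x)) (hA : SmoothEnd A) :
    Module.End ℝ (sections ξ) where
  toFun V := ⟨act A V, hA V V.2.1 V.2.2, act_mem A V⟩
  map_add' V W := Subtype.ext (act_map_add A V.2.2 W.2.2)
  map_smul' a V := Subtype.ext (act_map_smul A a V.2.2)

theorem SmoothEnd.mul {A B : (x : L) → Module.End ℝ (ξ x)} (hA : SmoothEnd A) (hB : SmoothEnd B) :
    SmoothEnd fun x => A x * B x := fun V hV tV => by
  rw [act_mul A B tV]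
  exact hA _ (hB V hV tV) (act_mem B V)

theorem SmoothEnd.add {A B : (x : L) → Module.End ℝ (ξ x)} (hA : SmoothEnd A) (hB : SmoothEnd B) :
    SmoothEnd fun x => A x + B x := fun V hV tV => by
  rw [act_add A B tV]
  exact (hA V hV tV).add (hB V hV tV)

theorem SmoothEnd.sub {A B : (x : L) → Module.End ℝ (ξ x)} (hA : SmoothEnd A) (hB : SmoothEnd B) :
    SmoothEnd fun x => A x - B x := fun V hV tV => by
  rw [act_sub A B tV]
  exact (hA V hV tV).sub (hB V hV tV)

theorem smoothEnd_one : SmoothEnd fun x => (1 : Module.End ℝ (ξ x)) := fun V hV tV => by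
  rwa [act_one tV]

end Tangent

variable {F : EndoDistribution n L}

theorem proj_coe (c : DefiningCouple F.ξ) (x : L) (v : F.ξ x) :
    proj c x (v : TangentSpace (𝓡 n) x) = v :=
  Subtype.ext (by simp [proj, (c.ker_γ x v).1 v.2])

theorem coe_proj (c : DefiningCouple F.ξ) (x : L) (v : TangentSpace (𝓡 n) x) :
    (proj c x v : TangentSpace (𝓡 n) x) = v - c.γ x v • c.X x := rfl

theorem proj_X (c : DefiningCouple F.ξ) (x : L) : proj c x (c.X x) = 0 :=
  Subtype.ext (by simp [coe_proj, c.γ_X])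

theorem proj_omegaAt (c : DefiningCouple F.ξ) (α : OneForm n L) (x : L) (v : F.ξ x) :
    proj c x (omegaAt c α x v) = v := by
  simp [omegaAt, proj_X, proj_coe]

/-- The inverse of a smooth field of automorphisms of `ξ` is smooth. -/
theorem SmoothEnd.inverse [T2Space L] (c : DefiningCouple F.ξ)
    {A : (x : L) → Module.End ℝ (F.ξ x)} (hA : SmoothEnd A) (hu : ∀ x, IsUnit (A x)) :
    SmoothEnd fun x => Ring.inverse (A x) := by
  intro V hV tV
  have htan : ∀ W : VField n L, TangentTo F.ξ fun x => (proj c x (W x) : TangentSpace (𝓡 n) x) :=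
    fun W x => (proj c x (W x)).2
  have hsm : ∀ W : VField n L, SmoothField W →
      SmoothField fun x => (proj c x (W x) : TangentSpace (𝓡 n) x) := fun W hW =>
    hW.sub ((c.smooth_γ.contMDiff hW).smul_section c.smooth_X)
  -- `A` is extended to the whole tangent space by the identity on the line of `X`, so that the
  -- criterion for endomorphisms of the tangent bundle applies.
  let B (x : L) : Module.End ℝ (TangentSpace (𝓡 n) x) :=
    (F.ξ x).subtype ∘ₗ A x ∘ₗ proj c x +
      (c.γ x : TangentSpace (𝓡 n) x →ₗ[ℝ] ℝ).smulRight (c.X x)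
  have hB : ∀ x v, B x v = (A x (proj c x v) : TangentSpace (𝓡 n) x) + c.γ x v • c.X x :=
    fun _ _ => rfl
  refine smoothField_of_smoothField_apply (A := B) (fun W hW => ?_) (fun x v hv => ?_) ?_
  · refine SmoothField.add (V := fun x => (A x (proj c x (W x)) : TangentSpace (𝓡 n) x)) ?_
      ((c.smooth_γ.contMDiff hW).smul_section c.smooth_X)
    have := hA _ (hsm W hW) (htan W)
    convert this using 1
    funext x
    rw [act_apply _ (htan W x)]
  · rw [hB] at hv
    have h1 := congrArg (c.γ x) hv
    simp only [map_add, map_smul, c.γ_X, (c.ker_γ x _).1 (A x (proj c x v)).2, zero_add,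
      smul_eq_mul, mul_one, map_zero] at h1
    rw [h1, zero_smul, add_zero, Submodule.coe_eq_zero] at hv
    have h2 : proj c x v = 0 := by
      have := congrArg (⇑(Ring.inverse (A x))) hv
      rwa [← Module.End.mul_apply, Ring.inverse_mul_cancel _ (hu x), map_zero] at this
    have h3 := congrArg Subtype.val h2
    simpa [coe_proj, h1] using h3
  · convert hV using 1
    funext x
    rw [hB, act_apply _ (tV x), proj_coe, (c.ker_γ x _).1 (Subtype.prop _), zero_smul, add_zero,
      ← Module.End.mul_apply, Ring.mul_inverse_cancel _ (hu x)]
    rfl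

-- The type of `J` depends on `ξ`; comparing values in the ambient tangent space avoids any
-- transport between the two distributions.
omit [IsManifold (𝓡 n) ∞ L] in
theorem EndoDistribution.ext_of_apply {F G : EndoDistribution n L}
    (hξ : ∀ x v, v ∈ F.ξ x ↔ v ∈ G.ξ x)
    (hJ : ∀ x v (hF : v ∈ F.ξ x) (hG : v ∈ G.ξ x),
      (F.J x ⟨v, hF⟩ : TangentSpace (𝓡 n) x) = G.J x ⟨v, hG⟩) : F = G := by
  obtain ⟨ξ, J⟩ := F
  obtain ⟨ξ', J'⟩ := G
  obtain rfl : ξ = ξ' := funext fun x => Submodule.ext (hξ x)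
  congr
  funext x
  exact LinearMap.ext fun v => Subtype.ext (hJ x v v.2 v.2)

end LeviFlat
end

noncomputable section
namespace LeviFlat

variable {n : ℕ} {L : Type*} [TopologicalSpace L] [ChartedSpace (EuclideanSpace ℝ (Fin n)) L]
  [IsManifold (𝓡 n) ∞ L] {F : EndoDistribution n L}

/-- The kernel of a one-form. -/
def kerDist (θ : OneForm n L) (x : L) : Submodule ℝ (TangentSpace (𝓡 n) x) :=
  LinearMap.ker (θ x : TangentSpace (𝓡 n) x →ₗ[ℝ] ℝ)

omit [IsManifold (𝓡 n) ∞ L] in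
theorem mem_kerDist {θ : OneForm n L} {x : L} {v : TangentSpace (𝓡 n) x} :
    v ∈ kerDist θ x ↔ θ x v = 0 := Iff.rfl

/-! ### The map ω_α and the bracket [·,·]_α -/

section Omega

variable (c : DefiningCouple F.ξ) {α : OneForm n L} (hα : SmoothFormOn α univ)
  (hX : ∀ x, α x (c.X x) = 0)

section Pointwise

variable {x : L}

include hX

theorem omegaAt_proj (v : TangentSpace (𝓡 n) x) :
    omegaAt c α x (proj c x v) = v - (c.γ + α) x v • c.X x := by
  simp only [omegaAt, LinearMap.coe_mk, AddHom.coe_mk, coe_proj, map_sub, map_smul, hX,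
    Pi.add_apply, add_apply, smul_eq_mul, mul_zero, sub_zero]
  module

theorem omegaAt_proj_of_mem {v : TangentSpace (𝓡 n) x} (hv : v ∈ kerDist (c.γ + α) x) :
    omegaAt c α x (proj c x v) = v := by
  rw [omegaAt_proj c hX, mem_kerDist.1 hv, zero_smul, sub_zero]

theorem omegaAt_mem (v : F.ξ x) : omegaAt c α x v ∈ kerDist (c.γ + α) x := by
  rw [mem_kerDist]
  simp [omegaAt, hX, c.γ_X, (c.ker_γ x _).1 v.2]

theorem tangentTo_omega {V : VField n L} (hV : TangentTo F.ξ V) :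
    TangentTo (kerDist (c.γ + α)) (omega c α V) := fun x => omegaAt_mem c hX ⟨V x, hV x⟩

theorem omega_omegaInv (V : VField n L) : omega c α (omegaInv c α V) = V := by
  funext x
  simp [omega, omegaInv, hX]

end Pointwise

theorem tangentTo_omegaInv {V : VField n L} (hV : TangentTo (kerDist (c.γ + α)) V) :
    TangentTo F.ξ (omegaInv c α V) := fun x => by
  have := mem_kerDist.1 (hV x)
  rw [c.ker_γ]
  simpa [omegaInv, c.γ_X] using this

theorem omega_add (V W : VField n L) : omega c α (V + W) = omega c α V + omega c α W := by
  funext x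
  simp only [omega, Pi.add_apply, map_add]
  module

theorem omega_smul (a : ℝ) (V : VField n L) : omega c α (a • V) = a • omega c α V := by
  funext x
  simp only [omega, Pi.smul_apply, map_smul, smul_eq_mul]
  module

theorem omegaInv_add (V W : VField n L) :
    omegaInv c α (V + W) = omegaInv c α V + omegaInv c α W := by
  funext x
  simp only [omegaInv, Pi.add_apply, map_add]
  module

theorem omegaInv_smul (a : ℝ) (V : VField n L) : omegaInv c α (a • V) = a • omegaInv c α V := by
  funext x
  simp only [omegaInv, Pi.smul_apply, map_smul, smul_eq_mul]
  module

/-- `ω_α` as a linear map on the sections of `ξ`. -/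
def omegaSections (α : OneForm n L) : sections F.ξ →ₗ[ℝ] VField n L where
  toFun V := omega c α V
  map_add' V W := omega_add c V.1 W.1
  map_smul' a V := omega_smul c a V.1

theorem lie_const_smul_right (a : ℝ) (V : VField n L) {W : VField n L} (hW : SmoothField W) :
    lie V (a • W) = a • lie V W :=
  funext fun x => VectorField.mlieBracket_const_smul_right (hW.mdifferentiableAt x)

theorem lie_const_smul_left (a : ℝ) {V : VField n L} (W : VField n L) (hV : SmoothField V) :
    lie (a • V) W = a • lie V W :=
  funext fun x => VectorField.mlieBracket_const_smul_left (hV.mdifferentiableAt x)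

theorem lie_neg_right (V : VField n L) {W : VField n L} (hW : SmoothField W) :
    lie V (-W) = -lie V W := by
  have := lie_const_smul_right (-1) V hW
  rwa [neg_one_smul, neg_one_smul] at this

theorem lie_neg_left {V : VField n L} (W : VField n L) (hV : SmoothField V) :
    lie (-V) W = -lie V W := by
  have := lie_const_smul_left (-1) W hV
  rwa [neg_one_smul, neg_one_smul] at this

include hα

theorem SmoothField.omega {V : VField n L} (hV : SmoothField V) : SmoothField (omega c α V) :=
  hV.sub ((hα.contMDiff hV).smul_section c.smooth_X)

theorem SmoothField.omegaInv {V : VField n L} (hV : SmoothField V) :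
    SmoothField (omegaInv c α V) :=
  hV.add ((hα.contMDiff hV).smul_section c.smooth_X)

omit hα in
theorem lieAlpha_swap (V W : VField n L) : lieAlpha c α V W = -lieAlpha c α W V := by
  rw [lieAlpha, lie_swap, ← neg_one_smul ℝ, omegaInv_smul, neg_one_smul, lieAlpha]

theorem lieAlpha_add_left {V V' : VField n L} (W : VField n L) (hV : SmoothField V)
    (hV' : SmoothField V') : lieAlpha c α (V + V') W = lieAlpha c α V W + lieAlpha c α V' W := by
  rw [lieAlpha, omega_add, lie_add_left (hV.omega c hα) (hV'.omega c hα), omegaInv_add]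
  rfl

theorem lieAlpha_smul_left (a : ℝ) {V : VField n L} (W : VField n L) (hV : SmoothField V) :
    lieAlpha c α (a • V) W = a • lieAlpha c α V W := by
  rw [lieAlpha, omega_smul, lie_const_smul_left a _ (hV.omega c hα), omegaInv_smul]
  rfl

theorem lieAlpha_add_right (V : VField n L) {W W' : VField n L} (hW : SmoothField W)
    (hW' : SmoothField W') : lieAlpha c α V (W + W') = lieAlpha c α V W + lieAlpha c α V W' := by
  rw [lieAlpha, omega_add, lie_add_right (hW.omega c hα) (hW'.omega c hα), omegaInv_add]
  rfl

theorem lieAlpha_smul_right (a : ℝ) (V : VField n L) {W : VField n L} (hW : SmoothField W) :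
    lieAlpha c α V (a • W) = a • lieAlpha c α V W := by
  rw [lieAlpha, omega_smul, lie_const_smul_right a _ (hW.omega c hα), omegaInv_smul]
  rfl

variable (hinv : Involutive (kerDist (c.γ + α)))

include hX hinv in
theorem lieAlpha_mem {V W : VField n L} (hV : V ∈ sections F.ξ) (hW : W ∈ sections F.ξ) :
    lieAlpha c α V W ∈ sections F.ξ :=
  ⟨((hV.1.omega c hα).lie (hW.1.omega c hα)).omegaInv c hα,
    tangentTo_omegaInv c (hinv _ _ (hV.1.omega c hα) (hW.1.omega c hα)
      (tangentTo_omega c hX hV.2) (tangentTo_omega c hX hW.2))⟩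

/-- The bracket `[·,·]_α` on the sections of `ξ`. -/
def bracketSections : sections F.ξ →ₗ[ℝ] sections F.ξ →ₗ[ℝ] sections F.ξ :=
  LinearMap.mk₂ ℝ (fun V W => ⟨lieAlpha c α V W, lieAlpha_mem c hα hX hinv V.2 W.2⟩)
    (fun V V' W => Subtype.ext (lieAlpha_add_left c hα W.1 V.2.1 V'.2.1))
    (fun a V W => Subtype.ext (lieAlpha_smul_left c hα a W.1 V.2.1))
    (fun V W W' => Subtype.ext (lieAlpha_add_right c hα V.1 W.2.1 W'.2.1))
    (fun a V W => Subtype.ext (lieAlpha_smul_right c hα a V.1 W.2.1))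

/-- Modulo `X` the bracket is tensorial in α: the derivatives of α(V) and α(W) from the Leibniz
rule, the term added by ω_α⁻¹ and the difference between T(V) and [V,X] are all multiples of `X`.
Their total `s` never has to be known. -/
theorem lieAlpha_apply_eq_add_smul {V W : VField n L} (hV : SmoothField V) (hW : SmoothField W)
    (x : L) : ∃ s : ℝ, lieAlpha c α V W x =
      lie V W x - α x (W x) • tForm c V x + α x (V x) • tForm c W x + s • c.X x := by
  have sV := hα.contMDiff hV
  have sW := hα.contMDiff hW
  have sVX := SmoothField.smul sV c.smooth_X
  have sWX := SmoothField.smul sW c.smooth_X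
  have eV : omega c α V = V + -((fun y => α y (V y)) • c.X) := sub_eq_add_neg _ _
  have eW : omega c α W = W + -((fun y => α y (W y)) • c.X) := sub_eq_add_neg _ _
  have key : ∃ s : ℝ, lie (omega c α V) (omega c α W) x =
      lie V W x - α x (W x) • lie V c.X x + α x (V x) • lie W c.X x + s • c.X x := by
    rw [eV, eW, lie_add_left hV sVX.neg, lie_add_right hW sWX.neg, lie_add_right hW sWX.neg,
      lie_neg_right _ sWX, lie_neg_left _ sVX, lie_neg_left _ sVX, lie_neg_right _ sWX]
    simp only [Pi.add_apply, Pi.neg_apply, lie_smul_right sW c.smooth_X,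
      lie_smul_left sV c.smooth_X, lie_swap c.X W, lie_self, Pi.zero_apply,
      dirDeriv_smul_left]
    refine ⟨-dirDeriv V (fun y => α y (W y)) x + dirDeriv W (fun y => α y (V y)) x
      - α x (W x) * dirDeriv c.X (fun y => α y (V y)) x
      + α x (V x) * dirDeriv c.X (fun y => α y (W y)) x, ?_⟩
    module
  obtain ⟨s, hs⟩ := key
  refine ⟨s + α x (lie (omega c α V) (omega c α W) x) - α x (W x) * c.γ x (lie V c.X x)
    + α x (V x) * c.γ x (lie W c.X x), ?_⟩
  rw [lieAlpha, omegaInv]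
  nth_rw 1 [hs]
  simp only [tForm]
  module

-- When ξ and ξ_α are both involutive, every other term lies in ξ; applying γ shows that the
-- multiple of `X` vanishes.
include hX hinv in
theorem lieAlpha_apply (hF : Involutive F.ξ) {V W : VField n L} (hV : V ∈ sections F.ξ)
    (hW : W ∈ sections F.ξ) (x : L) :
    lieAlpha c α V W x =
      lie V W x - α x (W x) • tForm c V x + α x (V x) • tForm c W x := by
  obtain ⟨s, hs⟩ := lieAlpha_apply_eq_add_smul c hα hV.1 hW.1 x
  have h0 : c.γ x (lieAlpha c α V W x) = 0 :=
    (c.ker_γ x _).1 ((lieAlpha_mem c hα hX hinv hV hW).2 x)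
  have h1 : c.γ x (lie V W x) = 0 :=
    (c.ker_γ x _).1 (hF _ _ hV.1 hW.1 hV.2 hW.2 x)
  rw [hs] at h0
  simp only [map_add, map_sub, map_smul, h1, tForm, c.γ_X, smul_eq_mul, mul_one, sub_self,
    mul_zero, zero_add, add_zero] at h0
  rw [hs, h0, zero_smul, add_zero]

end Omega

end LeviFlat
end

noncomputable section
namespace LeviFlat

variable {n : ℕ} {L : Type*} [TopologicalSpace L] [ChartedSpace (EuclideanSpace ℝ (Fin n)) L]
  [IsManifold (𝓡 n) ∞ L] {F : EndoDistribution n L}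

/-! ### The second Maurer-Cartan equation -/

section Integrability

variable (c : DefiningCouple F.ξ) {α : OneForm n L} (hα : SmoothFormOn α univ)
  (hX : ∀ x, α x (c.X x) = 0) (hinv : Involutive (kerDist (c.γ + α)))

theorem tForm_mem (V : VField n L) : TangentTo F.ξ (tForm c V) := fun x => by
  rw [c.ker_γ]
  simp [tForm, c.γ_X]

include hα hX hinv in
/-- The Nijenhuis tensor of `J` with respect to `[·,·]_α` is `-4 α^{0,1} ∧ H`. -/
theorem nijenhuis_lieAlpha (hF : IsLeviFlat F) {V W : VField n L}
    (hV : V ∈ sections F.ξ) (hW : W ∈ sections F.ξ) :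
    nijenhuis (lieAlpha c α) (act F.J) V W = -((4 : ℝ) • wedgeH c α V W) := by
  have hJV : act F.J V ∈ sections F.ξ := ⟨hF.smooth_J V hV.1 hV.2, act_mem F.J V⟩
  have hJW : act F.J W ∈ sections F.ξ := ⟨hF.smooth_J W hW.1 hW.2, act_mem F.J W⟩
  have hJJ : ∀ x (a : F.ξ x), F.J x (F.J x a) = -a := fun x a =>
    congrArg (fun A => A a) (hF.J_sq x)
  have tl : ∀ {A B : VField n L}, A ∈ sections F.ξ → B ∈ sections F.ξ → TangentTo F.ξ (lie A B) :=
    fun hA hB => hF.involutive _ _ hA.1 hB.1 hA.2 hB.2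
  funext x
  have hN := congrFun (hF.integrable V W hV.1 hW.1 hV.2 hW.2) x
  have tT : ∀ V, tForm c V x ∈ F.ξ x := fun V => tForm_mem c V x
  have aA : ∀ {A B : VField n L} (hA : A ∈ sections F.ξ) (hB : B ∈ sections F.ξ),
      act F.J (lieAlpha c α A B) x = (F.J x (⟨lie A B x, tl hA hB x⟩
        - α x (B x) • ⟨tForm c A x, tT A⟩ + α x (A x) • ⟨tForm c B x, tT B⟩) : F.ξ x) := by
    intro A B hA hB
    rw [act_apply _ ((lieAlpha_mem c hα hX hinv hA hB).2 x)]
    congr 2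
    exact Subtype.ext (lieAlpha_apply c hα hX hinv hF.involutive hA hB x)
  have aH : ∀ A : VField n L, hForm c A x = ((1 / 2 : ℝ) • ((⟨tForm c A x, tT A⟩ : F.ξ x)
      + F.J x ⟨tForm c (act F.J A) x, tT _⟩) : F.ξ x) := fun A => by
    simp only [hForm, Pi.smul_apply, Pi.add_apply, act_apply F.J (tT (act F.J A)),
      Submodule.coe_smul, Submodule.coe_add]
  have hHm : ∀ A : VField n L, hForm c A x ∈ F.ξ x := fun A => by
    rw [aH]
    exact Subtype.prop _
  have aJH : ∀ A : VField n L, act F.J (hForm c A) x =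
      (F.J x ((1 / 2 : ℝ) • ((⟨tForm c A x, tT A⟩ : F.ξ x)
      + F.J x ⟨tForm c (act F.J A) x, tT _⟩)) : F.ξ x) := fun A => by
    rw [act_apply _ (hHm A)]
    congr 2
    exact Subtype.ext (aH A)
  -- Here the b's are the Lie brackets [JV,JW], [V,W], [JV,W], [V,JW]. The part of the identity free
  -- of α is then the Nijenhuis tensor of the Lie bracket, zero by `hN`.
  have key := congrArg Subtype.val (nijenhuis_add_wedge (hJJ x) ⟨_, tl hJV hJW x⟩ ⟨_, tl hV hW x⟩
    ⟨_, tl hJV hW x⟩ ⟨_, tl hV hJW x⟩ ⟨_, tT V⟩ ⟨_, tT W⟩ ⟨_, tT (act F.J V)⟩ ⟨_, tT (act F.J W)⟩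
    (α x (V x)) (α x (W x)) (α x (act F.J V x)) (α x (act F.J W x)))
  simp only [nijenhuis, Pi.sub_apply, act_apply F.J (tl hJV hW x), act_apply F.J (tl hV hJW x),
    Pi.zero_apply] at hN
  simp only [nijenhuis, wedgeH, zeroOnePart, Pi.sub_apply, Pi.neg_apply, Pi.smul_apply,
    aA hJV hW, aA hV hJW, lieAlpha_apply c hα hX hinv hF.involutive hJV hJW,
    lieAlpha_apply c hα hX hinv hF.involutive hV hW, aH, aJH]
  simp only [Submodule.coe_sub, Submodule.coe_add, Submodule.coe_smul, hN, zero_sub] at key ⊢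
  exact key

variable {S : (x : L) → Module.End ℝ (F.ξ x)}

/-- Integrability of `ω_α (I + S) J (I + S)⁻¹ ω_α⁻¹` is the second Maurer-Cartan equation. -/
theorem eqS_iff_nijenhuis [T2Space L] (hF : IsLeviFlat F) (hS : SmoothEnd S)
    (hSJ : ∀ x, S x * F.J x = -(F.J x * S x)) (hu : ∀ x, IsUnit (1 + S x))
    {K : (x : L) → Module.End ℝ (F.ξ x)} (hK : SmoothEnd K)
    (hKS : ∀ x, K x * (1 + S x) = (1 + S x) * F.J x) (hinv : Involutive (kerDist (c.γ + α))) :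
    EqS c α S ↔ ∀ V W : sections F.ξ, nijenhuis (fun a b => bracketSections c hα hX hinv a b)
      (actSections K hK) V W = 0 := by
  -- The formal identity needs a bilinear bracket and linear operators, which are available on the
  -- space of smooth sections of ξ.
  set br := bracketSections c hα hX hinv
  set JΓ := actSections F.J hF.smooth_J with hJΓ
  set SΓ := actSections S hS with hSΓ
  set KΓ := actSections K hK with hKΓ
  have hmul : ∀ {A B : (x : L) → Module.End ℝ (F.ξ x)} (hA : SmoothEnd A) (hB : SmoothEnd B)
      (V : sections F.ξ), (actSections A hA (actSections B hB V) : VField n L) =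
        act (fun x => A x * B x) V := fun hA hB V => (act_mul _ _ V.2.2).symm
  have hSJΓ : ∀ a, SΓ (JΓ a) = -JΓ (SΓ a) := fun a => Subtype.ext <| by
    rw [Submodule.coe_neg, hJΓ, hSΓ, hmul, hmul]
    simp only [hSJ]
    rw [act_neg _ a.2.2]
  have h1 : ∀ a, KΓ (a + SΓ a) = JΓ a - JΓ (SΓ a) := fun a => by
    have e : (KΓ (a + SΓ a) : VField n L) = act (fun x => K x * (1 + S x)) a := by
      rw [act_mul _ _ a.2.2, act_add _ _ a.2.2, act_one a.2.2]
      rfl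
    rw [sub_eq_add_neg, ← hSJΓ]
    refine Subtype.ext (e.trans ?_)
    simp only [hKS, add_mul, one_mul]
    rw [act_add _ _ a.2.2, act_mul _ _ a.2.2]
    rfl
  have h2 : ∀ b, SΓ (KΓ b) = KΓ b - (JΓ b - JΓ (SΓ b)) := fun b => by
    rw [eq_sub_iff_add_eq, ← eq_sub_iff_add_eq']
    refine Subtype.ext ?_
    have e := act_sub F.J (fun x => F.J x * S x) b.2.2
    have e' := act_sub K (fun x => S x * K x) b.2.2
    rw [act_mul _ _ b.2.2] at e e'
    refine e.symm.trans (Eq.trans ?_ e')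
    congr 1
    funext x
    have := one_sub_mul_of_twist (hSJ x) (hu x) (hKS x)
    rw [sub_mul, mul_sub, one_mul, mul_one] at this
    exact this.symm
  have hinj : ∀ a, SΓ a = a → a = 0 := fun a ha => Subtype.ext <| funext fun x => by
    have e : act S a x = a.1 x := congrFun (congrArg Subtype.val ha) x
    rw [act_apply _ (a.2.2 x)] at e
    have e2 : (1 - S x) ⟨a.1 x, a.2.2 x⟩ = 0 := by
      rw [LinearMap.sub_apply, Module.End.one_apply, sub_eq_zero]
      exact Subtype.ext e.symm
    have := congrArg (⇑(Ring.inverse (1 - S x))) e2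
    rw [← Module.End.mul_apply, Ring.inverse_mul_cancel _
      (isUnit_one_sub (hF.J_sq x) (hSJ x) (hu x)), map_zero] at this
    exact congrArg Subtype.val this
  -- Every smooth section is (I+S)a with `a` smooth, thanks to smoothness of the pointwise inverse.
  have hsurj : ∀ b, ∃ a, a + SΓ a = b := fun b => by
    have hi := SmoothEnd.inverse c (smoothEnd_one.add hS) hu
    refine ⟨actSections _ hi b, Subtype.ext ?_⟩
    have e := act_mul (fun x => 1 + S x) (fun x => Ring.inverse (1 + S x)) b.2.2
    rw [act_add _ _ (act_mem _ _), act_one (act_mem _ _)] at e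
    refine e.symm.trans ?_
    simp only [Ring.mul_inverse_cancel _ (hu _)]
    exact act_one b.2.2
  -- Four times the defect in the second equation is −(I−S) N_K((I+S)V,(I+S)W): the term N_J of
  -- `nijenhuis_twist` is the −4 α^{0,1}∧H that has been moved to the left.
  have hlhs : ∀ V W : sections F.ξ, (4 : ℝ) • (dbarEnd (lieAlpha c α) (act F.J) (act S) V W
      + (1 / 2 : ℝ) • sDoubleBracket (lieAlpha c α) (act F.J) (act S) V W) + (4 : ℝ) • wedgeH c α V W
      = ((SΓ (nijenhuis (fun a b => br a b) KΓ (V + SΓ V) (W + SΓ W))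
        - nijenhuis (fun a b => br a b) KΓ (V + SΓ V) (W + SΓ W) : sections F.ξ) : VField n L) := by
    intro V W
    have key := congrArg Subtype.val
      (nijenhuis_twist (br := br) (fun a b => Subtype.ext (lieAlpha_swap c a.1 b.1))
        hSJΓ h1 h2 V W)
    have e1 := map_dbarEnd (br := fun a b => br a b) (sections F.ξ).subtype
      (br' := lieAlpha c α) (J := JΓ) (S := SΓ) (J' := act F.J) (S' := act S)
      (fun _ _ => rfl) (fun _ => rfl) (fun _ => rfl) V W
    have e2 := map_sDoubleBracket (br := fun a b => br a b) (sections F.ξ).subtype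
      (br' := lieAlpha c α) (J := JΓ) (S := SΓ) (J' := act F.J) (S' := act S)
      (fun _ _ => rfl) (fun _ => rfl) (fun _ => rfl) V W
    have e3 := map_nijenhuis (br := fun a b => br a b) (sections F.ξ).subtype
      (br' := lieAlpha c α) (J := JΓ) (J' := act F.J) (fun _ _ => rfl) (fun _ => rfl) V W
    simp only [Submodule.subtype_apply] at e1 e2 e3
    rw [nijenhuis_lieAlpha c hα hX hinv hF V.2 W.2] at e3
    simp only [Submodule.coe_smul, Submodule.coe_add, Submodule.coe_sub, e1, e2, e3] at key ⊢
    rw [key]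
    abel
  constructor
  · intro h V' W'
    obtain ⟨V, rfl⟩ := hsurj V'
    obtain ⟨W, rfl⟩ := hsurj W'
    have e := hlhs V W
    rw [h V W V.2.1 W.2.1 V.2.2 W.2.2, smul_neg, neg_add_cancel] at e
    exact hinj _ (sub_eq_zero.1 (Subtype.ext e.symm))
  · intro h V W hV hW tV tW
    have e := hlhs ⟨V, hV, tV⟩ ⟨W, hW, tW⟩
    rw [h, map_zero, sub_zero, ← smul_add, Submodule.coe_zero] at e
    exact eq_neg_of_add_eq_zero_left ((smul_eq_zero.1 e).resolve_left four_ne_zero)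

end Integrability

end LeviFlat
end

noncomputable section
namespace LeviFlat

variable {n : ℕ} {L : Type*} [TopologicalSpace L] [ChartedSpace (EuclideanSpace ℝ (Fin n)) L]
  [IsManifold (𝓡 n) ∞ L] {F : EndoDistribution n L}

/-! ### The structure defined by a pair -/

section Deform

variable (c : DefiningCouple F.ξ) (p : ZOne c × ZeroOneForm F)

theorem mem_deform {x : L} {v : TangentSpace (𝓡 n) x} :
    v ∈ (deform c p).ξ x ↔ (c.γ + p.1.1) x v = 0 := Iff.rfl

theorem deform_J_apply {x : L} (v : (deform c p).ξ x) :
    ((deform c p).J x v : TangentSpace (𝓡 n) x) =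
      omegaAt c p.1.1 x (twist p.2 x (proj c x (v : TangentSpace (𝓡 n) x))) := rfl

theorem gamma_add_X (x : L) : (c.γ + p.1.1) x (c.X x) = 1 := by
  have := p.1.2.2 x
  simp only [Pi.add_apply, add_apply, c.γ_X, this, add_zero]

/-- Together with ω_α[V,W]_α = [ω_α V, ω_α W], this transports integrability questions on ξ_α to ξ
with the bracket [·,·]_α. -/
theorem act_deform_omega {V : VField n L} (hV : TangentTo F.ξ V) :
    act (deform c p).J (omega c p.1.1 V) = omega c p.1.1 (act (twist p.2) V) := by
  funext x
  have h0 : TangentTo (deform c p).ξ (omega c p.1.1 V) := tangentTo_omega c p.1.2.2 hV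
  refine (act_apply _ (h0 x)).trans ?_
  rw [deform_J_apply]
  have h1 : proj c x (omega c p.1.1 V x) = ⟨V x, hV x⟩ := proj_omegaAt c p.1.1 x ⟨V x, hV x⟩
  have h2 : twist p.2 x ⟨V x, hV x⟩ = ⟨act (twist p.2) V x, act_mem _ V x⟩ :=
    Subtype.ext (act_apply _ (hV x)).symm
  simp only [h1, h2]
  rfl

theorem exists_omega_eq {V : VField n L} (hV : SmoothField V) (tV : TangentTo (deform c p).ξ V) :
    ∃ V' : sections F.ξ, omega c p.1.1 V' = V :=
  ⟨⟨omegaInv c p.1.1 V, hV.omegaInv c p.1.2.1, tangentTo_omegaInv c tV⟩,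
    omega_omegaInv c p.1.2.2 V⟩

theorem smoothCodimOne_deform : SmoothCodimOne (deform c p).ξ := fun x =>
  ⟨univ, isOpen_univ, mem_univ x, c.γ + p.1.1, c.smooth_γ.add p.1.2.1, fun y _ =>
    ⟨fun h => by simpa [h] using gamma_add_X c p y, fun _ => Iff.rfl⟩⟩

theorem involutive_deform_iff (hF : Involutive F.ξ) :
    Involutive (deform c p).ξ ↔ EqAlpha c p.1.1 := by
  rw [involutive_iff_curvature c.smooth_X (c.smooth_γ.add p.1.2.1) (gamma_add_X c p)
    (fun _ _ => Iff.rfl), EqAlpha]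
  have h0 := (involutive_iff_curvature c.smooth_X c.smooth_γ c.γ_X c.ker_γ).1 hF
  refine forall₅_congr fun V W hV hW x => ?_
  rw [curvature_add c.smooth_γ p.1.2.1 hV hW, h0 V W hV hW, zero_add]

variable {p}

theorem smoothEnd_twist [T2Space L] (hJ : SmoothEnd F.J) (hu : InvertibleS p.2) :
    SmoothEnd (twist p.2) :=
  have h1 := smoothEnd_one.add p.2.2.1
  (h1.mul hJ).mul (SmoothEnd.inverse c h1 hu)

theorem smoothEnd_deform [T2Space L] (hJ : SmoothEnd F.J) (hu : InvertibleS p.2) :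
    SmoothEnd (deform c p).J := fun V hV tV => by
  obtain ⟨V', rfl⟩ := exists_omega_eq c p hV tV
  rw [act_deform_omega c p V'.2.2]
  exact (smoothEnd_twist c hJ hu V' V'.2.1 V'.2.2).omega c p.1.2.1

theorem deform_J_sq (hJ : ∀ x, F.J x * F.J x = -1) (hu : InvertibleS p.2) (x : L) :
    (deform c p).J x * (deform c p).J x = -1 := by
  refine LinearMap.ext fun v => Subtype.ext ?_
  rw [Module.End.mul_apply, deform_J_apply, deform_J_apply, proj_omegaAt, ← Module.End.mul_apply]
  have : twist p.2 x * twist p.2 x = -1 := twist_mul_self (hJ x) (hu x)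
  rw [this, LinearMap.neg_apply, map_neg, Module.End.one_apply,
    omegaAt_proj_of_mem c p.1.2.2 v.2]
  rfl

theorem omegaSections_injective (α : OneForm n L) :
    Function.Injective (omegaSections c α) := fun V W h => Subtype.ext <| funext fun x => by
  have h1 : proj c x (omegaSections c α V x) = ⟨V.1 x, V.2.2 x⟩ :=
    proj_omegaAt c α x ⟨V.1 x, V.2.2 x⟩
  have h2 : proj c x (omegaSections c α W x) = ⟨W.1 x, W.2.2 x⟩ :=
    proj_omegaAt c α x ⟨W.1 x, W.2.2 x⟩
  rw [h, h2] at h1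
  exact (congrArg Subtype.val h1).symm

theorem integrable_deform_iff [T2Space L] (hF : IsLeviFlat F) (hu : InvertibleS p.2)
    (hinv : Involutive (deform c p).ξ) :
    (∀ V W : VField n L, SmoothField V → SmoothField W → TangentTo (deform c p).ξ V →
      TangentTo (deform c p).ξ W → nijenhuis lie (act (deform c p).J) V W = 0) ↔
    EqS c p.1.1 p.2.1 := by
  rw [eqS_iff_nijenhuis c p.1.2.1 p.1.2.2 hF p.2.2.1 p.2.2.2 hu
    (smoothEnd_twist c hF.smooth_J hu) (fun x => mul_one_add_of_twist (hu x) rfl) hinv]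
  have key := map_nijenhuis
    (br := fun a b => bracketSections c p.1.2.1 p.1.2.2 hinv a b) (br' := lie)
    (J := actSections _ (smoothEnd_twist c hF.smooth_J hu)) (J' := act (deform c p).J)
    (omegaSections c p.1.1) (fun V W => omega_omegaInv c p.1.2.2 _)
    (fun V => (act_deform_omega c p V.2.2).symm)
  constructor
  · intro h V W
    have h1 := (key V W).trans (h _ _ (V.2.1.omega c p.1.2.1) (W.2.1.omega c p.1.2.1)
      (tangentTo_omega c p.1.2.2 V.2.2) (tangentTo_omega c p.1.2.2 W.2.2))
    rw [← map_zero (omegaSections c p.1.1)] at h1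
    exact omegaSections_injective c p.1.1 h1
  · intro h V W hV hW tV tW
    obtain ⟨V', rfl⟩ := exists_omega_eq c p hV tV
    obtain ⟨W', rfl⟩ := exists_omega_eq c p hW tW
    refine (key V' W').symm.trans ?_
    rw [h, map_zero]

/-- Codimension one, smoothness and J² = −I hold for every pair with I+S invertible; only the two
integrability conditions remain. Involutivity is treated first, since it is what makes [·,·]_α
preserve the sections of ξ. -/
theorem isLeviFlat_deform_iff [T2Space L] (hF : IsLeviFlat F) (hu : InvertibleS p.2) :
    IsLeviFlat (deform c p) ↔ p ∈ MC c := by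
  constructor
  · intro h
    exact ⟨(involutive_deform_iff c p hF.involutive).1 h.involutive,
      (integrable_deform_iff c hF hu h.involutive).1 h.integrable⟩
  · rintro ⟨h1, h2⟩
    have hinv := (involutive_deform_iff c p hF.involutive).2 h1
    exact ⟨smoothCodimOne_deform c p, hinv, smoothEnd_deform c hF.smooth_J hu,
      deform_J_sq c hF.J_sq hu, (integrable_deform_iff c hF hu hinv).2 h2⟩

theorem deform_zero (h1 : ∀ x, p.1.1 x = 0) (h2 : ∀ x, p.2.1 x = 0) : deform c p = F := by
  refine EndoDistribution.ext_of_apply (fun x v => ?_) (fun x v hD hF => ?_)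
  · rw [mem_deform, c.ker_γ, Pi.add_apply, h1, add_zero]
  · have ht : twist p.2 x = F.J x := by simp [twist, h2]
    rw [deform_J_apply, ht]
    simp only [omegaAt, h1, LinearMap.coe_mk, AddHom.coe_mk, zero_apply, zero_smul, sub_zero]
    congr 2
    exact proj_coe c x ⟨v, hF⟩

/-- Transversality holds because (γ+α)(X) = 1. With K the twisted J, the map in the second condition
is (J+K)π, where J+K is invertible and π is injective on ξ_α. -/
theorem closeTo_deform (hJ : ∀ x, F.J x * F.J x = -1) (hu : InvertibleS p.2) :
    CloseTo c (deform c p) := by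
  refine fun x => ⟨fun h => ?_, fun v hv => ?_⟩
  · have := (mem_deform c p).1 h
    rw [gamma_add_X] at this
    exact one_ne_zero this
  · rw [deform_J_apply, proj_omegaAt, ← LinearMap.add_apply] at hv
    have hK := isUnit_add_of_twist (hJ x) (p.2.2.2 x) (hu x)
      (mul_one_add_of_twist (hu x) (rfl : twist p.2 x = _))
    have h0 := congrArg (⇑(Ring.inverse (F.J x + twist p.2 x))) hv
    rw [← Module.End.mul_apply, Ring.inverse_mul_cancel _ hK, map_zero, Module.End.one_apply] at h0
    apply Subtype.ext
    rw [← omegaAt_proj_of_mem c p.1.2.2 v.2, h0, map_zero]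
    rfl

end Deform

/-- The vector v − θ(v)X lies in ker θ. The normalisation on `X` thus makes a form depend only on
its kernel. -/
theorem oneForm_eq_of_ker {X : VField n L} {θ η : OneForm n L} {x : L} (hθ : θ x (X x) = 1)
    (hη : η x (X x) = 1) (h : ∀ v, θ x v = 0 → η x v = 0) : θ x = η x := by
  ext v
  have := h (v - θ x v • X x) (by simp [hθ])
  rw [map_sub, map_smul, hη, smul_eq_mul, mul_one, sub_eq_zero] at this
  exact this.symm

/-- A pair is determined by the distribution and by the endomorphism `(I + S) J (I + S)⁻¹`. -/
theorem pair_ext (c : DefiningCouple F.ξ) (hJ : ∀ x, F.J x * F.J x = -1)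
    {p q : ZOne c × ZeroOneForm F} (hp : InvertibleS p.2) (hq : InvertibleS q.2)
    (h : deform c p = deform c q) : p = q := by
  have hα : p.1.1 = q.1.1 := funext fun x => by
    have := oneForm_eq_of_ker (gamma_add_X c p x) (gamma_add_X c q x) fun v hv => by
      rw [← mem_deform c, ← h]
      exact (mem_deform c p).2 hv
    exact add_left_cancel this
  have ht : ∀ x, twist p.2 x = twist q.2 x := fun x => LinearMap.ext fun v => by
    -- Generalising one structure to a variable `G` allows substitution along the equality, which
    -- cannot be rewritten directly inside the dependent type of `J`.
    have hG : ∀ G : EndoDistribution n L, G = deform c q →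
        ∀ w (hw : w ∈ G.ξ x) (hw' : w ∈ (deform c q).ξ x),
          (G.J x ⟨w, hw⟩ : TangentSpace (𝓡 n) x) = (deform c q).J x ⟨w, hw'⟩ := by
      rintro _ rfl w _ _
      rfl
    have e := hG _ h (omegaAt c p.1.1 x v) (omegaAt_mem c p.1.2.2 v)
      (by rw [hα]; exact omegaAt_mem c q.1.2.2 v)
    rw [deform_J_apply, deform_J_apply] at e
    have := congrArg (proj c x) e
    simpa only [proj_omegaAt] using this
  have hS : p.2.1 = q.2.1 := funext fun x => by
    rw [← cayley_of_twist (hJ x) (p.2.2.2 x) (hp x)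
      (mul_one_add_of_twist (hp x) (rfl : twist p.2 x = _)), ht,
      cayley_of_twist (hJ x) (q.2.2.2 x) (hq x)
      (mul_one_add_of_twist (hq x) (rfl : twist q.2 x = _))]
  exact Prod.ext (Subtype.ext hα) (Subtype.ext hS)

end LeviFlat
end

noncomputable section
namespace LeviFlat

variable {n : ℕ} {L : Type*} [TopologicalSpace L] [ChartedSpace (EuclideanSpace ℝ (Fin n)) L]
  [IsManifold (𝓡 n) ∞ L] {F : EndoDistribution n L}

/-! ### Every deformation comes from a pair -/

section Surjective

/-- A smooth distribution of codimension one transverse to `X` is the kernel of a smooth one-form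
`θ` with `θ (X) = 1`. -/
theorem SmoothCodimOne.exists_form {ξ : (x : L) → Submodule ℝ (TangentSpace (𝓡 n) x)}
    (hξ : SmoothCodimOne ξ) {X : VField n L} (hX : SmoothField X) (htr : ∀ x, X x ∉ ξ x) :
    ∃ θ : OneForm n L, SmoothFormOn θ univ ∧ (∀ x, θ x (X x) = 1) ∧
      ∀ x v, v ∈ ξ x ↔ θ x v = 0 := by
  choose U hU hxU θ hθ hker using hξ
  have hne : ∀ x, ∀ y ∈ U x, θ x y (X y) ≠ 0 := fun x y hy h =>
    htr y (((hker x y hy).2 _).2 h)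
  -- Once normalised by their value on `X`, the local forms agree on overlaps, so they glue without
  -- a partition of unity.
  have hloc : ∀ x, ∀ y ∈ U x,
      (θ y y (X y))⁻¹ • θ y y = (θ x y (X y))⁻¹ • θ x y := fun x y hy => by
    refine oneForm_eq_of_ker (X := X) (θ := fun z => (θ z z (X z))⁻¹ • θ z z)
      (η := fun z => (θ x z (X z))⁻¹ • θ x z) (x := y) ?_ ?_ fun v hv => ?_
    · simpa using inv_mul_cancel₀ (hne y y (hxU y))
    · simpa using inv_mul_cancel₀ (hne x y hy)
    · have h1 : θ y y v = 0 := by simpa [hne y y (hxU y)] using hv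
      have h2 := ((hker x y hy).2 v).1 (((hker y y (hxU y)).2 v).2 h1)
      simp [h2]
  refine ⟨fun y => (θ y y (X y))⁻¹ • θ y y, fun V hV => contMDiffOn_univ.2 fun x => ?_,
    fun x => by simpa using inv_mul_cancel₀ (hne x x (hxU x)), fun x v => ?_⟩
  · have h1 := (hθ x V hV).contMDiffAt ((hU x).mem_nhds (hxU x))
    have h2 := (hθ x X hX).contMDiffAt ((hU x).mem_nhds (hxU x))
    refine ContMDiffAt.congr_of_eventuallyEq (h1.div₀ h2 (hne x x (hxU x))) ?_
    filter_upwards [(hU x).mem_nhds (hxU x)] with y hy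
    simp only [hloc x y hy, smul_apply, smul_eq_mul, Pi.div_apply]
    rw [div_eq_inv_mul]
  · rw [(hker x x (hxU x)).2 v]
    simp [hne x x (hxU x)]

theorem SmoothField.proj (c : DefiningCouple F.ξ) {V : VField n L} (hV : SmoothField V) :
    SmoothField fun x => (LeviFlat.proj c x (V x) : TangentSpace (𝓡 n) x) :=
  hV.sub ((c.smooth_γ.contMDiff hV).smul_section c.smooth_X)

theorem SmoothFormOn.sub {θ η : OneForm n L} {U : Set L} (hθ : SmoothFormOn θ U)
    (hη : SmoothFormOn η U) : SmoothFormOn (θ - η) U :=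
  fun V hV => (hθ V hV).sub (hη V hV)

instance (x : L) : FiniteDimensional ℝ (TangentSpace (𝓡 n) x) :=
  inferInstanceAs (FiniteDimensional ℝ (EuclideanSpace ℝ (Fin n)))

/-- Every deformation comes from a pair `(α, S)`. -/
theorem exists_deform_eq [T2Space L] (hF : IsLeviFlat F) (c : DefiningCouple F.ξ)
    {G : EndoDistribution n L} (hG : IsLeviFlat G) (hc : CloseTo c G) :
    ∃ p : ZOne c × ZeroOneForm F, InvertibleS p.2 ∧ deform c p = G := by
  obtain ⟨θ, hθ, hθX, hker⟩ := hG.codim_one.exists_form c.smooth_X fun x => (hc x).1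
  obtain ⟨α, hαθ⟩ : ∃ α : OneForm n L, α = θ - c.γ := ⟨_, rfl⟩
  have hα : SmoothFormOn α univ := hαθ ▸ hθ.sub c.smooth_γ
  have hX : ∀ x, α x (c.X x) = 0 := fun x => by simp [hαθ, hθX, c.γ_X]
  have hadd : c.γ + α = θ := by rw [hαθ]; abel
  have hξ : ∀ x v, v ∈ G.ξ x ↔ v ∈ kerDist (c.γ + α) x := fun x v => by
    rw [hker, mem_kerDist, hadd]
  have hmem : ∀ x (v : F.ξ x), omegaAt c α x v ∈ G.ξ x := fun x v =>
    (hξ x _).2 (omegaAt_mem c hX v)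
  have hback : ∀ x (v : G.ξ x), omegaAt c α x (proj c x (v : TangentSpace (𝓡 n) x)) = v :=
    fun x v => omegaAt_proj_of_mem c hX ((hξ x _).1 v.2)
  -- This is ω_α⁻¹ J' ω_α, the complex structure of `G` carried to ξ; its Cayley transform will be
  -- S.
  let K (x : L) : Module.End ℝ (F.ξ x) :=
    proj c x ∘ₗ (G.ξ x).subtype ∘ₗ G.J x ∘ₗ (omegaAt c α x).codRestrict (G.ξ x) (hmem x)
  have hKdef : ∀ x v, K x v =
      proj c x (G.J x ⟨omegaAt c α x v, hmem x v⟩ : TangentSpace (𝓡 n) x) := fun _ _ => rfl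
  have hKproj : ∀ x (w : G.ξ x), K x (proj c x (w : TangentSpace (𝓡 n) x)) =
      proj c x (G.J x w : TangentSpace (𝓡 n) x) := fun x w => by
    rw [hKdef]
    congr 3
    exact Subtype.ext (hback x w)
  have hK2 : ∀ x, K x * K x = -1 := fun x => LinearMap.ext fun v => by
    rw [Module.End.mul_apply, hKdef x v, hKproj, ← Module.End.mul_apply, hG.J_sq]
    simp only [LinearMap.neg_apply, Module.End.one_apply, Submodule.coe_neg, map_neg,
      proj_omegaAt]
  -- Closeness gives injectivity of J+K, and ξ_x is finite-dimensional.
  have hunit : ∀ x, IsUnit (F.J x + K x) := fun x => by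
    rw [LinearMap.isUnit_iff_ker_eq_bot, LinearMap.ker_eq_bot']
    intro v hv
    have h0 := (hc x).2 ⟨omegaAt c α x v, hmem x v⟩ (by
      rw [LinearMap.add_apply, hKdef] at hv
      rwa [proj_omegaAt])
    rw [← proj_omegaAt c α x v]
    exact (congrArg (fun w : G.ξ x => proj c x (w : TangentSpace (𝓡 n) x)) h0).trans (map_zero _)
  have hKs : SmoothEnd K := fun V hV tV => by
    have t : TangentTo G.ξ (omega c α V) := fun x => hmem x ⟨V x, tV x⟩
    convert (hG.smooth_J _ (hV.omega c hα) t).proj c using 1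
    funext x
    rw [act_apply _ (tV x), act_apply _ (t x), hKdef]
    rfl
  let p : ZOne c × ZeroOneForm F := ⟨⟨α, hα, hX⟩, ⟨fun x => cayley (F.J x) (K x),
    (SmoothEnd.inverse c (hF.smooth_J.add hKs) hunit).mul (hF.smooth_J.sub hKs),
    fun x => cayley_anticomm (hF.J_sq x) (hK2 x) (hunit x)⟩⟩
  have ht : ∀ x, twist p.2 x = K x := fun x => twist_cayley (hF.J_sq x) (hK2 x) (hunit x)
  refine ⟨p, fun x => isUnit_one_add_cayley (hF.J_sq x) (hunit x),
    EndoDistribution.ext_of_apply (fun x v => (hξ x v).symm) fun x v _ hv => ?_⟩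
  rw [deform_J_apply, ht]
  exact (congrArg _ (hKproj x ⟨v, hv⟩)).trans (hback x _)

theorem bijOn_deform [T2Space L] (hF : IsLeviFlat F) (c : DefiningCouple F.ξ) :
    BijOn (deform c) {p | p ∈ MC c ∧ InvertibleS p.2} {G | IsLeviFlat G ∧ CloseTo c G} := by
  refine ⟨fun p hp => ⟨(isLeviFlat_deform_iff c hF hp.2).2 hp.1, closeTo_deform c hF.J_sq hp.2⟩,
    fun p hp q hq h => pair_ext c hF.J_sq hp.2 hq.2 h, fun G hG => ?_⟩
  obtain ⟨p, hp, rfl⟩ := exists_deform_eq hF c hG.1 hG.2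
  exact ⟨p, ⟨(isLeviFlat_deform_iff c hF hp).1 hG.1, hp⟩, rfl⟩

end Surjective

end LeviFlat
end

noncomputable section
namespace LeviFlat

variable {n : ℕ} {L : Type*} [TopologicalSpace L] [ChartedSpace (EuclideanSpace ℝ (Fin n)) L]
  [IsManifold (𝓡 n) ∞ L]

/-! ### Push-forward and pull-back of vector fields -/

section Diffeo

variable (Φ : Diffeomorph (𝓡 n) (𝓡 n) L L ∞)

/-- The differential of a diffeomorphism, as a linear equivalence. -/
def diffEquiv (x : L) : TangentSpace (𝓡 n) x ≃L[ℝ] TangentSpace (𝓡 n) (Φ x) :=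
  Φ.mfderivToContinuousLinearEquiv (by simp) x

theorem coe_diffEquiv (x : L) : (diffEquiv Φ x : TangentSpace (𝓡 n) x →L[ℝ] _) =
    mfderiv (𝓡 n) (𝓡 n) Φ x := rfl

theorem diffEquiv_apply (x : L) (v : TangentSpace (𝓡 n) x) :
    diffEquiv Φ x v = mfderiv (𝓡 n) (𝓡 n) Φ x v := rfl

theorem inverse_mfderiv (x : L) :
    (mfderiv (𝓡 n) (𝓡 n) Φ x).inverse = ((diffEquiv Φ x).symm : _ →L[ℝ] _) := by
  rw [← coe_diffEquiv, ContinuousLinearMap.inverse_equiv]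

theorem isInvertible_mfderiv (x : L) : (mfderiv (𝓡 n) (𝓡 n) Φ x).IsInvertible :=
  ⟨diffEquiv Φ x, rfl⟩

theorem mfderiv_injective (x : L) : Function.Injective (mfderiv (𝓡 n) (𝓡 n) Φ x) :=
  (diffEquiv Φ x).injective

-- All tangent spaces are the model space by definition. Stating the equality there avoids a
-- transport between the fibres at `x` and `f x`.
omit [IsManifold (𝓡 n) ∞ L] in
theorem mfderiv_apply_of_eq_id {f : L → L} (hf : f = id) (x : L) (v : EuclideanSpace ℝ (Fin n)) :
    (mfderiv (𝓡 n) (𝓡 n) f x v : EuclideanSpace ℝ (Fin n)) = v := by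
  subst hf
  rw [mfderiv_id]
  rfl

theorem mfderiv_symm_mfderiv (x : L) (v : EuclideanSpace ℝ (Fin n)) :
    (mfderiv (𝓡 n) (𝓡 n) Φ.symm (Φ x) (mfderiv (𝓡 n) (𝓡 n) Φ x v) : EuclideanSpace ℝ (Fin n))
      = v := by
  have h := mfderiv_comp x (Φ.symm.mdifferentiable (by simp) (Φ x))
    (Φ.mdifferentiable (by simp) x)
  exact (congrArg (fun A : EuclideanSpace ℝ (Fin n) →L[ℝ] EuclideanSpace ℝ (Fin n) => A v)
    h.symm).trans (mfderiv_apply_of_eq_id (funext Φ.symm_apply_apply) x v)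

theorem mfderiv_mfderiv_symm (y : L) (v : EuclideanSpace ℝ (Fin n)) :
    (mfderiv (𝓡 n) (𝓡 n) Φ (Φ.symm y) (mfderiv (𝓡 n) (𝓡 n) Φ.symm y v) :
      EuclideanSpace ℝ (Fin n)) = v :=
  mfderiv_symm_mfderiv Φ.symm y v

/-- The push-forward of a vector field by a diffeomorphism. -/
def push (V : VField n L) : VField n L := VectorField.mpullback (𝓡 n) (𝓡 n) Φ.symm V

theorem push_apply (V : VField n L) (x : L) :
    push Φ V (Φ x) = mfderiv (𝓡 n) (𝓡 n) Φ x (V x) := by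
  rw [push, VectorField.mpullback_apply, inverse_mfderiv]
  refine (ContinuousLinearEquiv.symm_apply_eq _).2 ?_
  have h : (V (Φ.symm (Φ x)) : EuclideanSpace ℝ (Fin n)) = V x := by rw [Φ.symm_apply_apply]
  exact h.trans (mfderiv_symm_mfderiv Φ x (V x)).symm

theorem SmoothField.push {V : VField n L} (hV : SmoothField V) : SmoothField (push Φ V) :=
  ContMDiff.mpullback_vectorField (m := ∞) (n := ∞) hV Φ.symm.contMDiff
    (isInvertible_mfderiv Φ.symm) (by simp)

/-- The pull-back of a vector field by a diffeomorphism. -/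
def pull (V : VField n L) : VField n L := VectorField.mpullback (𝓡 n) (𝓡 n) Φ V

theorem SmoothField.pull {V : VField n L} (hV : SmoothField V) : SmoothField (pull Φ V) :=
  ContMDiff.mpullback_vectorField (m := ∞) (n := ∞) hV Φ.contMDiff
    (isInvertible_mfderiv Φ) (by simp)

theorem mfderiv_pull (V : VField n L) (x : L) :
    mfderiv (𝓡 n) (𝓡 n) Φ x (pull Φ V x) = V (Φ x) := by
  rw [pull, VectorField.mpullback_apply, inverse_mfderiv]
  exact (diffEquiv Φ x).apply_symm_apply _

theorem pull_push (V : VField n L) : pull Φ (push Φ V) = V := funext fun x =>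
  mfderiv_injective Φ x ((mfderiv_pull Φ _ x).trans (push_apply Φ V x))

theorem pull_lie {V W : VField n L} (hV : SmoothField V) (hW : SmoothField W) :
    pull Φ (lie V W) = lie (pull Φ V) (pull Φ W) := by
  have : IsManifold (𝓡 n) (minSmoothness ℝ 2) L := by
    rw [minSmoothness_of_isRCLikeNormedField]
    infer_instance
  have : IsManifold (𝓡 n) (minSmoothness ℝ 3) L := by
    rw [minSmoothness_of_isRCLikeNormedField]
    infer_instance
  funext x
  exact VectorField.mpullback_mlieBracket (hV.mdifferentiableAt _) (hW.mdifferentiableAt _)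
    (Φ.contMDiff x) (by rw [minSmoothness_of_isRCLikeNormedField]; exact WithTop.coe_le_coe.2 le_top)

end Diffeo

/-! ### Isomorphisms of structures -/

section Iso

variable {Φ Ψ : Diffeomorph (𝓡 n) (𝓡 n) L L ∞} {F G K : EndoDistribution n L}

theorem isIsoBy_refl (F : EndoDistribution n L) :
    IsIsoBy (Diffeomorph.refl (𝓡 n) L ∞) F F := by
  have h : ∀ x (v : TangentSpace (𝓡 n) x),
      mfderiv (𝓡 n) (𝓡 n) (Diffeomorph.refl (𝓡 n) L ∞) x v = v := fun x v =>
    mfderiv_apply_of_eq_id (Diffeomorph.coe_refl (𝓡 n) L ∞) x v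
  refine ⟨fun x v => ?_, fun x v w hw => ?_⟩
  · rw [h]
    rfl
  · have hw' : w = v := Subtype.ext (hw.trans (h x v))
    rw [hw']
    exact (h x _).symm

/-- Inverting an isomorphism involves the base point Φ(Φ⁻¹ y), equal to y only propositionally;
hence the free point `y` and the comparison of vectors in the model space. -/
theorem IsIsoBy.mem_iff_of_eq (h : IsIsoBy Φ F G) {x y : L} (hxy : Φ x = y)
    (v : TangentSpace (𝓡 n) x) (w : TangentSpace (𝓡 n) y)
    (hw : (w : EuclideanSpace ℝ (Fin n)) = mfderiv (𝓡 n) (𝓡 n) Φ x v) :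
    v ∈ F.ξ x ↔ w ∈ G.ξ y := by
  subst hxy
  rw [h.1 x v]
  exact iff_of_eq (congrArg (· ∈ G.ξ (Φ x)) hw.symm)

theorem IsIsoBy.J_of_eq (h : IsIsoBy Φ F G) {x y : L} (hxy : Φ x = y)
    (v : F.ξ x) (w : G.ξ y)
    (hw : ((w : TangentSpace (𝓡 n) y) : EuclideanSpace ℝ (Fin n)) = mfderiv (𝓡 n) (𝓡 n) Φ x v) :
    ((G.J y w : TangentSpace (𝓡 n) y) : EuclideanSpace ℝ (Fin n)) =
      mfderiv (𝓡 n) (𝓡 n) Φ x (F.J x v : TangentSpace (𝓡 n) x) := by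
  subst hxy
  exact h.2 x v w hw

theorem IsIsoBy.symm (h : IsIsoBy Φ F G) : IsIsoBy Φ.symm G F := by
  refine ⟨fun y v => ?_, fun y v w hw => ?_⟩
  · exact (h.mem_iff_of_eq (Φ.apply_symm_apply y) (mfderiv (𝓡 n) (𝓡 n) Φ.symm y v) v
      (mfderiv_mfderiv_symm Φ y v).symm).symm
  · have h1 := h.J_of_eq (Φ.apply_symm_apply y) w v (by
      rw [hw]
      exact (mfderiv_mfderiv_symm Φ y (v : TangentSpace (𝓡 n) y)).symm)
    apply mfderiv_injective Φ (Φ.symm y)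
    exact h1.symm.trans (mfderiv_mfderiv_symm Φ y (G.J y v : TangentSpace (𝓡 n) y)).symm

theorem IsIsoBy.trans (h : IsIsoBy Φ F G) (h' : IsIsoBy Ψ G K) : IsIsoBy (Φ.trans Ψ) F K := by
  have hd : ∀ x (v : TangentSpace (𝓡 n) x), mfderiv (𝓡 n) (𝓡 n) (Φ.trans Ψ) x v =
      mfderiv (𝓡 n) (𝓡 n) Ψ (Φ x) (mfderiv (𝓡 n) (𝓡 n) Φ x v) := fun x v => by
    have := mfderiv_comp x (Ψ.mdifferentiable (by simp) (Φ x)) (Φ.mdifferentiable (by simp) x)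
    exact congrArg (fun A => A v) this
  refine ⟨fun x v => ?_, fun x v w hw => ?_⟩
  · rw [h.1, h'.1, hd]
    rfl
  · have hm := (h.1 x v).1 v.2
    have h1 := h.2 x v ⟨_, hm⟩ rfl
    have h2 := h'.2 (Φ x) ⟨_, hm⟩ w (hw.trans (hd x v))
    rw [hd, ← h1]
    exact h2

theorem isomorphic_equivalence :
    Equivalence (Isomorphic : EndoDistribution n L → EndoDistribution n L → Prop) :=
  ⟨fun F => ⟨_, isIsoBy_refl F⟩, fun ⟨_, h⟩ => ⟨_, h.symm⟩, fun ⟨_, h⟩ ⟨_, h'⟩ => ⟨_, h.trans h'⟩⟩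

theorem IsIsoBy.tangentTo_push (h : IsIsoBy Φ F G) {V : VField n L} (hV : TangentTo F.ξ V) :
    TangentTo G.ξ (push Φ V) := fun y => by
  obtain ⟨x, rfl⟩ := Φ.surjective y
  have := (h.1 x _).1 (hV x)
  rw [← push_apply] at this
  exact this

theorem IsIsoBy.tangentTo_pull (h : IsIsoBy Φ F G) {V : VField n L} (hV : TangentTo G.ξ V) :
    TangentTo F.ξ (pull Φ V) := fun x => by
  rw [h.1, mfderiv_pull]
  exact hV _

theorem IsIsoBy.pull_act (h : IsIsoBy Φ F G) {V : VField n L} (hV : TangentTo G.ξ V) :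
    pull Φ (act G.J V) = act F.J (pull Φ V) := funext fun x => by
  apply mfderiv_injective Φ x
  rw [mfderiv_pull, act_apply _ (hV _), act_apply _ (h.tangentTo_pull hV x)]
  exact h.2 x _ _ (mfderiv_pull Φ V x).symm

/-- Levi flat structures are invariant under diffeomorphisms. -/
theorem IsIsoBy.isLeviFlat (h : IsIsoBy Φ F G) (hG : IsLeviFlat G) : IsLeviFlat F := by
  refine ⟨fun x => ?_, fun V W hV hW tV tW => ?_, fun V hV tV => ?_, fun x => ?_,
    fun V W hV hW tV tW => ?_⟩
  · obtain ⟨U, hU, hxU, θ, hθ, hker⟩ := hG.codim_one (Φ x)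
    refine ⟨Φ ⁻¹' U, hU.preimage Φ.continuous, hxU,
      fun y => (θ (Φ y)).comp (mfderiv (𝓡 n) (𝓡 n) Φ y), fun V hV => ?_, fun y hy => ⟨fun h0 => ?_,
        fun v => (h.1 y v).trans ((hker _ hy).2 _)⟩⟩
    · have := (hθ _ (hV.push Φ)).comp Φ.contMDiff.contMDiffOn (fun y (hy : y ∈ Φ ⁻¹' U) => hy)
      refine this.congr fun y _ => ?_
      simp only [Function.comp_apply, push_apply, ContinuousLinearMap.comp_apply]
    · refine (hker _ hy).1 (ContinuousLinearMap.ext fun w => ?_)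
      have := congrArg (fun A => A ((diffEquiv Φ y).symm w)) h0
      simp only [ContinuousLinearMap.comp_apply] at this
      rw [← diffEquiv_apply, ContinuousLinearEquiv.apply_symm_apply] at this
      exact this
  · rw [← pull_push Φ V, ← pull_push Φ W, ← pull_lie Φ (hV.push Φ) (hW.push Φ)]
    exact h.tangentTo_pull (hG.involutive _ _ (hV.push Φ) (hW.push Φ) (h.tangentTo_push tV)
      (h.tangentTo_push tW))
  · rw [← pull_push Φ V, ← h.pull_act (h.tangentTo_push tV)]
    exact (hG.smooth_J _ (hV.push Φ) (h.tangentTo_push tV)).pull Φ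
  · refine LinearMap.ext fun v => Subtype.ext (mfderiv_injective Φ x ?_)
    have h1 := h.2 x v ⟨_, (h.1 x v).1 v.2⟩ rfl
    have h2 := h.2 x (F.J x v) _ h1
    rw [← Module.End.mul_apply, hG.J_sq] at h2
    rw [Module.End.mul_apply, ← h2]
    simp only [LinearMap.neg_apply, Module.End.one_apply, Submodule.coe_neg, map_neg]
  · have hsm : ∀ V W : sections G.ξ, lie V.1 W.1 ∈ sections G.ξ := fun V W =>
      ⟨V.2.1.lie W.2.1, hG.involutive _ _ V.2.1 W.2.1 V.2.2 W.2.2⟩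
    -- Pull-back respects brackets and intertwines the two complex structures, so it carries the
    -- Nijenhuis tensor of `G`, which is zero, to that of `F`.
    let φ : sections G.ξ →ₗ[ℝ] VField n L :=
      { toFun := fun V => pull Φ V
        map_add' := fun V W => VectorField.mpullback_add
        map_smul' := fun a V => VectorField.mpullback_const_smul }
    let br (V W : sections G.ξ) : sections G.ξ := ⟨_, hsm V W⟩
    obtain ⟨V', hV'⟩ : ∃ V' : sections G.ξ, V'.1 = push Φ V :=
      ⟨⟨_, hV.push Φ, h.tangentTo_push tV⟩, rfl⟩
    obtain ⟨W', hW'⟩ : ∃ W' : sections G.ξ, W'.1 = push Φ W :=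
      ⟨⟨_, hW.push Φ, h.tangentTo_push tW⟩, rfl⟩
    have key := map_nijenhuis φ (br := br) (br' := lie)
      (J := actSections G.J hG.smooth_J) (J' := act F.J)
      (fun V W => pull_lie Φ V.2.1 W.2.1) (fun V => h.pull_act V.2.2) V' W'
    have h0 := map_nijenhuis (sections G.ξ).subtype (br := br) (br' := lie)
      (J := actSections G.J hG.smooth_J) (J' := act G.J) (fun V W => rfl) (fun V => rfl) V' W'
    have h1 := h0.trans (hG.integrable _ _ V'.2.1 W'.2.1 V'.2.2 W'.2.2)
    have hz : nijenhuis br (actSections G.J hG.smooth_J) V' W' = 0 := Subtype.ext h1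
    rw [hz, map_zero] at key
    have e : ∀ V, φ V = pull Φ V := fun _ => rfl
    simpa only [e, hV', hW', pull_push] using key.symm

/-- The pull-back of a field of endomorphisms of a distribution. -/
def pullEndo (Φ : Diffeomorph (𝓡 n) (𝓡 n) L L ∞) (G : EndoDistribution n L) :
    EndoDistribution n L where
  ξ x := (G.ξ (Φ x)).comap (mfderiv (𝓡 n) (𝓡 n) Φ x : TangentSpace (𝓡 n) x →ₗ[ℝ] _)
  J x := (((diffEquiv Φ x).symm : TangentSpace (𝓡 n) (Φ x) →ₗ[ℝ] TangentSpace (𝓡 n) x) ∘ₗ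
    (G.ξ (Φ x)).subtype ∘ₗ G.J (Φ x) ∘ₗ
      (mfderiv (𝓡 n) (𝓡 n) Φ x : TangentSpace (𝓡 n) x →ₗ[ℝ] _).restrict
        (fun _ h => h)).codRestrict _ fun v => by
    rw [Submodule.mem_comap]
    convert (G.J (Φ x) ((mfderiv (𝓡 n) (𝓡 n) Φ x : TangentSpace (𝓡 n) x →ₗ[ℝ] _).restrict
      (fun _ h => h) v)).2
    exact (diffEquiv Φ x).apply_symm_apply _

theorem isIsoBy_pullEndo (Φ : Diffeomorph (𝓡 n) (𝓡 n) L L ∞) (G : EndoDistribution n L) :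
    IsIsoBy Φ (pullEndo Φ G) G := by
  refine ⟨fun x v => Iff.rfl, fun x v w hw => ?_⟩
  have hw' : w = ⟨mfderiv (𝓡 n) (𝓡 n) Φ x v, v.2⟩ := Subtype.ext hw
  rw [hw']
  exact ((diffEquiv Φ x).apply_symm_apply _).symm

end Iso
end LeviFlat
end

noncomputable section
namespace LeviFlat

variable {n : ℕ} {L : Type*} [TopologicalSpace L] [ChartedSpace (EuclideanSpace ℝ (Fin n)) L]
  [IsManifold (𝓡 n) ∞ L] {F : EndoDistribution n L}

/-! ### The gauge action as isomorphism of structures -/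

section Gauge

variable (c : DefiningCouple F.ξ) {Φ : Diffeomorph (𝓡 n) (𝓡 n) L L ∞}
  {p q : ZOne c × ZeroOneForm F}

theorem pullForm_eq_zero_iff (x : L) (v : TangentSpace (𝓡 n) x) :
    pullForm c Φ p.1 x v = 0 ↔ mfderiv (𝓡 n) (𝓡 n) Φ x v ∈ (deform c p).ξ (Φ x) := Iff.rfl

theorem gamma_add_chi (x : L) : (c.γ + chi c Φ p.1) x =
    (pullForm c Φ p.1 x (c.X x))⁻¹ • pullForm c Φ p.1 x := by
  rw [Pi.add_apply, chi, add_sub_cancel]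

theorem chi_X (x : L) (h : pullForm c Φ p.1 x (c.X x) ≠ 0) : chi c Φ p.1 x (c.X x) = 0 := by
  simp only [chi, sub_apply, smul_apply, smul_eq_mul, inv_mul_cancel₀ h, c.γ_X, sub_self]

/-- If `Φ` is an isomorphism from the structure of `q` to the structure of `p`, then the gauge
action of `Φ` on `p` is defined, with value `q`. -/
theorem gaugeBy_of_isIsoBy (hJ : ∀ x, F.J x * F.J x = -1) (hq : InvertibleS q.2)
    (h : IsIsoBy Φ (deform c q) (deform c p)) : GaugeBy c Φ p q := by
  have hne : ∀ x, pullForm c Φ p.1 x (c.X x) ≠ 0 := fun x h0 => by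
    have h1 := (h.1 x _).2 ((pullForm_eq_zero_iff c x _).1 h0)
    rw [mem_deform, gamma_add_X] at h1
    exact one_ne_zero h1
  -- Both forms take the value 1 on `X` after adding γ, and Φ matches their kernels.
  have hβ : q.1.1 = chi c Φ p.1 := funext fun x => by
    refine add_left_cancel (a := c.γ x) (oneForm_eq_of_ker (X := c.X) (θ := c.γ + q.1.1)
      (η := c.γ + chi c Φ p.1) (gamma_add_X c q x) ?_ fun v hv => ?_)
    · simp only [gamma_add_chi, smul_apply, smul_eq_mul, inv_mul_cancel₀ (hne x)]
    · have h1 := (pullForm_eq_zero_iff c x v).2 ((h.1 x v).1 ((mem_deform c q).2 hv))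
      simp only [gamma_add_chi, smul_apply, h1, smul_zero]
  -- Φ_* intertwines the two complex structures, so the pulled-back endomorphism is (I+Q)J(I+Q)⁻¹,
  -- and its Cayley transform is Q.
  have hK : ∀ x, pulledJ c Φ p x = twist q.2 x := fun x => LinearMap.ext fun v => by
    have hm : omegaAt c q.1.1 x v ∈ (deform c q).ξ x := omegaAt_mem c q.1.2.2 v
    have h1 := h.2 x ⟨_, hm⟩ ⟨_, (h.1 x _).1 hm⟩ rfl
    rw [deform_J_apply c q, proj_omegaAt] at h1
    have h2 : pulledJ c Φ p x v = proj c x ((mfderiv (𝓡 n) (𝓡 n) Φ x).inverse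
        (jAlpha c p.1 p.2 (Φ x) (mfderiv (𝓡 n) (𝓡 n) Φ x (omegaAt c (chi c Φ p.1) x v)))) := rfl
    rw [h2, ← hβ]
    refine (congrArg (fun w => proj c x ((mfderiv (𝓡 n) (𝓡 n) Φ x).inverse w)) h1).trans ?_
    simp only [(isInvertible_mfderiv Φ x).inverse_apply_self, proj_omegaAt]
  have hm := fun x => mul_one_add_of_twist (hq x) (rfl : twist q.2 x = _)
  refine ⟨fun x => ⟨hne x, ?_⟩, hβ, funext fun x => ?_⟩
  · rw [hK]
    exact isUnit_add_of_twist (hJ x) (q.2.2.2 x) (hq x) (hm x)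
  · rw [gaugeS, hK]
    exact (cayley_of_twist (hJ x) (q.2.2.2 x) (hq x) (hm x)).symm

/-- The two clauses in the definedness of the action give the two closeness conditions: Φ^*(γ+α)(X)
≠ 0 is transversality, and on the pulled-back distribution the map Jπ + πJ' is J + `pulledJ`
composed with π. -/
theorem closeTo_pullEndo (h : GaugeDefined c Φ p) : CloseTo c (pullEndo Φ (deform c p)) := by
  have hX : ∀ x, chi c Φ p.1 x (c.X x) = 0 := fun x => chi_X c x (h x).1
  refine fun x => ⟨fun hx => (h x).1 ((pullForm_eq_zero_iff c x _).2 hx), fun v hv => ?_⟩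
  have hker : (v : TangentSpace (𝓡 n) x) ∈ kerDist (c.γ + chi c Φ p.1) x := by
    have h1 : pullForm c Φ p.1 x v = 0 := (pullForm_eq_zero_iff c x _).2 v.2
    rw [mem_kerDist]
    simp only [gamma_add_chi, smul_apply, h1, smul_zero]
  have hback := omegaAt_proj_of_mem c hX hker
  have h1 : pulledJ c Φ p x (proj c x (v : TangentSpace (𝓡 n) x)) =
      proj c x ((pullEndo Φ (deform c p)).J x v : TangentSpace (𝓡 n) x) := by
    have h2 : pulledJ c Φ p x (proj c x (v : TangentSpace (𝓡 n) x)) =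
      proj c x ((mfderiv (𝓡 n) (𝓡 n) Φ x).inverse (jAlpha c p.1 p.2 (Φ x)
        (mfderiv (𝓡 n) (𝓡 n) Φ x (omegaAt c (chi c Φ p.1) x
          (proj c x (v : TangentSpace (𝓡 n) x)))))) := rfl
    rw [h2, hback, inverse_mfderiv]
    rfl
  rw [← h1, ← LinearMap.add_apply] at hv
  have h0 := congrArg (⇑(Ring.inverse (F.J x + pulledJ c Φ p x))) hv
  rw [← Module.End.mul_apply, Ring.inverse_mul_cancel _ (h x).2, map_zero,
    Module.End.one_apply] at h0
  apply Subtype.ext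
  rw [← hback, h0]
  exact map_zero _

variable [T2Space L] (hF : IsLeviFlat F)

-- The pull-back by Φ is Levi flat by naturality and close to (ξ,J), so surjectivity of the
-- parametrisation provides the solution.
include hF in
theorem exists_isIsoBy_of_gaugeDefined (p : MCPair c) (h : GaugeDefined c Φ p.1) :
    ∃ q : MCPair c, IsIsoBy Φ (deform c q.1) (deform c p.1) := by
  have hiso := isIsoBy_pullEndo Φ (deform c p.1)
  have hp : IsLeviFlat (deform c p.1) := (isLeviFlat_deform_iff c hF p.2.2).2 p.2.1
  obtain ⟨q, hq, hqG⟩ := (bijOn_deform hF c).surjOn ⟨hiso.isLeviFlat hp, closeTo_pullEndo c h⟩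
  exact ⟨⟨q, hq⟩, hqG ▸ hiso⟩

omit [T2Space L] in
theorem GaugeBy.unique {q' : ZOne c × ZeroOneForm F} (h : GaugeBy c Φ p q)
    (h' : GaugeBy c Φ p q') : q = q' :=
  Prod.ext (Subtype.ext (h.2.1.trans h'.2.1.symm)) (Subtype.ext (h.2.2.trans h'.2.2.symm))

include hF in
theorem existsUnique_gaugeBy (p : MCPair c) (h : GaugeDefined c Φ p.1) :
    ∃! q : MCPair c, GaugeBy c Φ p.1 q.1 := by
  obtain ⟨q, hq⟩ := exists_isIsoBy_of_gaugeDefined c hF p h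
  have hg := gaugeBy_of_isIsoBy c hF.J_sq q.2.2 hq
  exact ⟨q, hg, fun q' h' => Subtype.ext (h'.unique c hg)⟩

-- Φ goes from the structure of `q` to that of `p` because the action is by pull-back. For the
-- direct implication, some solution `q'` has the pulled-back structure; it is then a value of the
-- action, and that value is unique.
include hF in
theorem gaugeBy_iff_isIsoBy (p q : MCPair c) :
    GaugeBy c Φ p.1 q.1 ↔ IsIsoBy Φ (deform c q.1) (deform c p.1) := by
  refine ⟨fun h => ?_, gaugeBy_of_isIsoBy c hF.J_sq q.2.2⟩
  obtain ⟨q', hq'⟩ := exists_isIsoBy_of_gaugeDefined c hF p h.1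
  rw [h.unique c (gaugeBy_of_isIsoBy c hF.J_sq q'.2.2 hq')]
  exact hq'

include hF in
theorem gaugeEquiv_iff_isomorphic (p q : MCPair c) :
    GaugeEquiv c p q ↔ Isomorphic (deform c p.1) (deform c q.1) :=
  (exists_congr fun _ => gaugeBy_iff_isIsoBy c hF p q).trans
    ⟨isomorphic_equivalence.symm, isomorphic_equivalence.symm⟩

-- Composing the formulas would require checking that the action of the composite is defined.
-- Through isomorphisms this is automatic, as an isomorphism between two deformed structures always
-- makes the action defined.
include hF in
theorem gaugeEquiv_equivalence : Equivalence (GaugeEquiv c) := by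
  refine ⟨fun p => ?_, fun {p q} h => ?_, fun {p q r} h h' => ?_⟩
  · rw [gaugeEquiv_iff_isomorphic c hF]
    exact isomorphic_equivalence.refl _
  · rw [gaugeEquiv_iff_isomorphic c hF] at *
    exact isomorphic_equivalence.symm h
  · rw [gaugeEquiv_iff_isomorphic c hF] at *
    exact isomorphic_equivalence.trans h h'

/-- The bijection from the solutions onto the deformations. -/
def deformEquiv : MCPair c ≃ Deformation c :=
  Set.BijOn.equiv (deform c) (bijOn_deform hF c)

end Gauge
end LeviFlat
end
open LeviFlat in
theorem mainTheorem5 {n : ℕ} {L : Type*} [TopologicalSpace L] [T2Space L]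
    [SecondCountableTopology L] [ChartedSpace (EuclideanSpace ℝ (Fin n)) L]
    [IsManifold (𝓡 n) ∞ L] (F : EndoDistribution n L) (hF : IsLeviFlat F)
    (c : DefiningCouple F.ξ) :
    -- the structure defined by a pair is Levi flat exactly for the solutions
    (∀ p : ZOne c × ZeroOneForm F, InvertibleS p.2 → (IsLeviFlat (deform c p) ↔ p ∈ MC c)) ∧
    -- the pair `(0, 0)` defines `(ξ, J)`
    (∀ p : ZOne c × ZeroOneForm F, (∀ x, p.1.1 x = 0) → (∀ x, p.2.1 x = 0) → deform c p = F) ∧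
    -- the deformations are parametrised by the solutions
    BijOn (deform c) {p | p ∈ MC c ∧ InvertibleS p.2} {G | IsLeviFlat G ∧ CloseTo c G} ∧
    -- a diffeomorphism takes solutions to solutions
    (∀ (p : MCPair c) (Φ : Diffeomorph (𝓡 n) (𝓡 n) L L ∞), GaugeDefined c Φ p.1 →
      ∃! q : MCPair c, GaugeBy c Φ p.1 q.1) ∧
    -- gauge equivalence is an equivalence relation; it is isomorphism of the structures
    Equivalence (GaugeEquiv c) ∧
    (∀ p q : MCPair c, GaugeEquiv c p q ↔ Isomorphic (deform c p.1) (deform c q.1)) ∧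
    -- the moduli space is the set of solutions modulo gauge equivalence
    ∃ e : MCQuotient c ≃ ModuliSpace c, ∀ (p : MCPair c) (G : Deformation c),
      deform c p.1 = G.1 → e (Quot.mk _ p) = Quot.mk _ G := by
  refine ⟨fun p => isLeviFlat_deform_iff c hF, fun p => deform_zero c, bijOn_deform hF c,
    fun p Φ => existsUnique_gaugeBy c hF p, gaugeEquiv_equivalence c hF,
    gaugeEquiv_iff_isomorphic c hF,
    Quot.congr (deformEquiv c hF) (gaugeEquiv_iff_isomorphic c hF), fun p G h => ?_⟩
  exact congrArg (Quot.mk _) (Subtype.ext h)
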